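/- Let $h$ be a Gaussian random variable, possibly degenerate and not necessarily centered, and let $\beta\ge 0$ and $\boldsymbol\beta=(\beta_p)_{p\ge 1}\in\mathbb{R}^{\mathbb{N}}$ satisfy $\sum_{p\ge 1}2^p\beta_p^2<\infty$. Let $(h_i)_{i\ge 1}$ be i.i.d. copies of $h$, and let $(g_{i_1,\dots,i_{2p}})_{p\ge 1,\; i_1,\dots,i_{2p}\ge 1}$ be i.i.d. standard Gaussian random variables independent of $(h_i)_{i\ge 1}$. For $N\ge 1$ and $\sigma\in\{-1,+1\}^N$ set $m(\sigma)=N^{-1}\sum_{i\le N}\sigma_i$ and $$H_N(\sigma)=\frac{\beta N}{2}m(\sigma)^2+\sum_{p\ge 1}\frac{\beta_p}{N^{p-1/2}}\sum_{1\le i_1,\dots,i_{2p}\le N}g_{i_1,\dots,i_{2p}}\sigma_{i_1}\cdots\sigma_{i_{2p}}+\sum_{i\le N}h_i\sigma_i,$$ and let $F_N(\beta,\boldsymbol\beta,h)=N^{-1}\,\mathbb{E}\ln\sum_{\sigma\in\{-1,+1\}^N}\exp H_N(\sigma)$ be the free energy. Almost surely the series over $p$ converges absolutely for every $\sigma$,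 and the expectation is that of an integrable random variable. Let $F_N^{SK}(\boldsymbol\beta,h)=F_N(0,\boldsymbol\beta,h)$ be the free energy of the mixed even-spin Sherrington-Kirkpatrick model. For every $\mu\in[-1,1]$ the limit $$F^{SK}(\boldsymbol\beta,\beta\mu+h)=\lim_{N\to\infty}F_N^{SK}(\boldsymbol\beta,\beta\mu+h)$$ exists, where the external field at site $i$ is $\beta\mu+h_i$. Moreover, $\lim_{N\to\infty}F_N(\beta,\boldsymbol\beta,h)$ exists, and $$\lim_{N\to\infty}F_N(\beta,\boldsymbol\beta,h)=\max_{\mu\in[-1,1]}\left\{F^{SK}(\boldsymbol\beta,\beta\mu+h)-\frac{\beta\mu^2}{2}\right\},$$ where the maximum is attained. -/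

import Mathlib

open MeasureTheory ProbabilityTheory Filter Topology Set
open scoped NNReal

noncomputable section

namespace SKFI

/-- The set of (inverse) temperatures `(β, (β_p)_{p ≥ 1})` with `β ≥ 0` and
`∑_{p ≥ 1} 2^p β_p² < ∞`. The `β_p` may be negative. -/
def temperatures : Set (ℝ × (ℕ+ → ℝ)) :=
  {b | 0 ≤ b.1 ∧ Summable fun p : ℕ+ => (2 : ℝ) ^ (p : ℕ) * b.2 p ^ 2}

/-- The configuration space `{-1, +1}^N`; the group `ℤˣ` is `{1, -1}`. -/
abbrev Config (N : ℕ) : Type := Fin N → ℤˣ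

/-- The spin at site `i`, as a real number. -/
def spin {N : ℕ} (σ : Config N) (i : Fin N) : ℝ := ((σ i : ℤ) : ℝ)

/-- A realization of the coupling array: `g p i` is `g_{i_1, …, i_{2p}}` for `p ≥ 1`.
Sites are numbered from `0`. -/
abbrev Couplings (Ω : Type*) : Type _ := (p : ℕ+) → (Fin (2 * (p : ℕ)) → ℕ) → Ω → ℝ

/-- `g` is an array of standard Gaussian random variables, `h` is a sequence of Gaussian random
variables of mean `m` and variance `v` (a constant if `v = 0`), and all of these random variables
are jointly independent. -/
structure IsDisorder {Ω : Type*} [MeasurableSpace Ω] (P : Measure Ω)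
    (g : Couplings Ω) (h : ℕ → Ω → ℝ) (m : ℝ) (v : ℝ≥0) : Prop where
  law_couplings : ∀ p i, HasLaw (g p i) (gaussianReal 0 1) P
  law_field : ∀ i, HasLaw (h i) (gaussianReal m v) P
  indep : iIndepFun
    (Sum.elim (fun q : (p : ℕ+) × (Fin (2 * (p : ℕ)) → ℕ) => g q.1 q.2) h) P

/-- The magnetization per site `N⁻¹ ∑_i σ_i`. -/
def magnetization {N : ℕ} (σ : Config N) : ℝ := (N : ℝ)⁻¹ * ∑ i, spin σ i

section Model

variable {Ω : Type*}

/-- The `2p`-spin interaction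
`β_p N^{-(p - 1/2)} ∑_{i_1, …, i_{2p}} g_{i_1, …, i_{2p}} σ_{i_1} ⋯ σ_{i_{2p}}`. -/
def pSpinTerm (B : ℕ+ → ℝ) (g : Couplings Ω) (N : ℕ) (ω : Ω) (σ : Config N) (p : ℕ+) : ℝ :=
  B p / (N : ℝ) ^ ((p : ℝ) - 1 / 2) *
    ∑ i : Fin (2 * (p : ℕ)) → Fin N, g p (fun k => (i k : ℕ)) ω * ∏ k, spin σ (i k)

/-- The mixed even `p`-spin interaction. -/
def skInteraction (B : ℕ+ → ℝ) (g : Couplings Ω) (N : ℕ) (ω : Ω) (σ : Config N) : ℝ :=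
  ∑' p : ℕ+, pSpinTerm B g N ω σ p

/-- The Hamiltonian of the SK model with ferromagnetic interaction and external field `h`. -/
def hamiltonian (β : ℝ) (B : ℕ+ → ℝ) (g : Couplings Ω) (h : ℕ → Ω → ℝ) (N : ℕ) (ω : Ω)
    (σ : Config N) : ℝ :=
  β * N / 2 * magnetization σ ^ 2 + skInteraction B g N ω σ + ∑ i : Fin N, h i ω * spin σ i

/-- The partition function. -/
def partitionFunction (β : ℝ) (B : ℕ+ → ℝ) (g : Couplings Ω) (h : ℕ → Ω → ℝ) (N : ℕ)
    (ω : Ω) : ℝ :=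
  ∑ σ : Config N, Real.exp (hamiltonian β B g h N ω σ)

/-- The free energy `N⁻¹ E log Z_N`. -/
def freeEnergy [MeasurableSpace Ω] (P : Measure Ω) (β : ℝ) (B : ℕ+ → ℝ) (g : Couplings Ω)
    (h : ℕ → Ω → ℝ) (N : ℕ) : ℝ :=
  (N : ℝ)⁻¹ * ∫ ω, Real.log (partitionFunction β B g h N ω) ∂P

/-- The free energy of the mixed even-spin SK model (no ferromagnetic interaction). -/
def freeEnergySK [MeasurableSpace Ω] (P : Measure Ω) (B : ℕ+ → ℝ) (g : Couplings Ω)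
    (h : ℕ → Ω → ℝ) (N : ℕ) : ℝ :=
  freeEnergy P 0 B g h N

/-- The limiting free energy of the mixed even-spin SK model (meaningful when the limit exists). -/
def limitFreeEnergySK [MeasurableSpace Ω] (P : Measure Ω) (B : ℕ+ → ℝ) (g : Couplings Ω)
    (h : ℕ → Ω → ℝ) : ℝ :=
  limUnder atTop (freeEnergySK P B g h)

/-- The external field shifted by the constant `c`. -/
def shiftField (c : ℝ) (h : ℕ → Ω → ℝ) : ℕ → Ω → ℝ := fun i ω => c + h i ω

end Model

end SKFI

end

/-! Completing the square, `β m² / 2 = β μ m - β μ² / 2 + β (m - μ)² / 2` compares the model with a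
pure spin glass in the field `β μ + h`. Since `β ≥ 0`, dropping the last square gives the lower
bound for every `μ` (`freeEnergySK_sub_le_freeEnergy`). Conversely, every magnetization lies within
`ε` of a point of a finite grid in `[-1, 1]`, so the partition function is at most `exp (N β ε² /
2)` times a finite sum of spin-glass partition functions, one per grid point. At scale `N` the
logarithm of such a sum is a maximum, and each term deviates from its mean by `O(√N)` in `L¹`; this
gives the upper bound (`freeEnergy_le_of_finite`).

The spin-glass limit exists by the Guerra–Toninelli argument. The covariance is `N ξ(overlap)` with
`ξ` convex on `[-1, 1]`, because it has a linear term and even powers only. Cutting the system into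
two independent blocks keeps the variances and raises the covariances, which lowers the free energy
(`integral_logSumExp_anti`), so `N F_N` is superadditive. The random field belongs to the Gaussian
vector, as the linear term of `ξ`. The limit is 1-Lipschitz in the field shift, so compactness gives
a maximizer.

No Gaussian integration by parts is used. Comparison adds small independent Gaussian increments and
expands log-sum-exp to third order; concentration rotates one Gaussian copy into an independent one
(Maurey–Pisier). -/

noncomputable section

namespace SKFI

/-! ### Log-sum-exp: Lipschitz bound and Taylor expansions with global remainders. -/

section LogSumExp

variable {ι : Type*} [Fintype ι]

/-- The function `x ↦ log ∑ i, exp (x i)`. -/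
def logSumExp (x : ι → ℝ) : ℝ := Real.log (∑ i, Real.exp (x i))

/-- The Gibbs weights, the gradient of `logSumExp`. -/
def gibbs (x : ι → ℝ) (i : ι) : ℝ := Real.exp (x i) / ∑ j, Real.exp (x j)

lemma sum_exp_pos [Nonempty ι] (x : ι → ℝ) : 0 < ∑ i, Real.exp (x i) :=
  Finset.sum_pos (fun _ _ => Real.exp_pos _) Finset.univ_nonempty

lemma gibbs_nonneg (x : ι → ℝ) (i : ι) : 0 ≤ gibbs x i :=
  div_nonneg (Real.exp_pos _).le (Finset.sum_nonneg fun _ _ => (Real.exp_pos _).le)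

lemma sum_gibbs [Nonempty ι] (x : ι → ℝ) : ∑ i, gibbs x i = 1 := by
  simp only [gibbs, ← Finset.sum_div]
  exact div_self (sum_exp_pos x).ne'

lemma logSumExp_add_sub [Nonempty ι] (x y : ι → ℝ) :
    logSumExp (x + y) - logSumExp x = Real.log (∑ i, gibbs x i * Real.exp (y i)) := by
  rw [logSumExp, logSumExp, ← Real.log_div (sum_exp_pos _).ne' (sum_exp_pos _).ne']
  congr 1
  simp only [gibbs, Pi.add_apply, Real.exp_add, Finset.sum_div]
  exact Finset.sum_congr rfl fun i _ => by ring

lemma continuous_logSumExp [Nonempty ι] : Continuous (logSumExp : (ι → ℝ) → ℝ) := by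
  unfold logSumExp
  exact Continuous.log (by fun_prop) fun x => (sum_exp_pos x).ne'

lemma logSumExp_mono [Nonempty ι] {x y : ι → ℝ} (h : ∀ i, x i ≤ y i) :
    logSumExp x ≤ logSumExp y :=
  Real.log_le_log (sum_exp_pos x) (Finset.sum_le_sum fun i _ => Real.exp_le_exp.2 (h i))

lemma logSumExp_const_add [Nonempty ι] (c : ℝ) (x : ι → ℝ) :
    logSumExp (fun i => c + x i) = c + logSumExp x := by
  simp only [logSumExp, Real.exp_add, ← Finset.mul_sum]
  rw [Real.log_mul (Real.exp_pos _).ne' (sum_exp_pos x).ne', Real.log_exp]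

lemma abs_logSumExp_sub_le [Nonempty ι] {x y : ι → ℝ} {r : ℝ} (h : ∀ i, |x i - y i| ≤ r) :
    |logSumExp x - logSumExp y| ≤ r := by
  have key : ∀ x y : ι → ℝ, (∀ i, |x i - y i| ≤ r) → logSumExp x ≤ r + logSumExp y := by
    intro x y h
    rw [← logSumExp_const_add]
    exact logSumExp_mono fun i => by linarith [le_abs_self (x i - y i), h i]
  rw [abs_sub_le_iff]
  constructor
  · linarith [key x y h]
  · linarith [key y x fun i => by rw [abs_sub_comm]; exact h i]

lemma abs_logSumExp_sub_le_norm [Nonempty ι] (x y : ι → ℝ) :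
    |logSumExp x - logSumExp y| ≤ ‖x - y‖ :=
  abs_logSumExp_sub_le fun i => by simpa using norm_le_pi_norm (x - y) i

section Weights

variable {p y : ι → ℝ} {r : ℝ}

lemma abs_sum_weight_mul_le (hp : ∀ i, 0 ≤ p i) (hp1 : ∑ i, p i = 1) {z : ι → ℝ}
    (h : ∀ i, |z i| ≤ r) : |∑ i, p i * z i| ≤ r := by
  calc |∑ i, p i * z i| ≤ ∑ i, |p i * z i| := Finset.abs_sum_le_sum_abs _ _
    _ ≤ ∑ i, p i * r := Finset.sum_le_sum fun i _ => by
        rw [abs_mul, abs_of_nonneg (hp i)]; exact mul_le_mul_of_nonneg_left (h i) (hp i)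
    _ = r := by rw [← Finset.sum_mul, hp1, one_mul]

lemma abs_log_one_add_sub_le {u : ℝ} (hu : |u| ≤ 1 / 2) :
    |Real.log (1 + u) - u + u ^ 2 / 2| ≤ 2 * |u| ^ 3 := by
  have h := Real.abs_log_sub_add_sum_range_le (x := -u) (by rw [abs_neg]; linarith) 2
  simp only [Finset.sum_range_succ, Finset.sum_range_zero, abs_neg, sub_neg_eq_add] at h
  norm_num at h
  have e : Real.log (1 + u) - u + u ^ 2 / 2 = -u + u ^ 2 / 2 + Real.log (1 + u) := by ring
  rw [e]
  refine h.trans ?_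
  rw [div_le_iff₀ (by linarith)]
  have : 0 ≤ |u| ^ 3 := by positivity
  nlinarith

lemma abs_exp_sub_quadratic_le {x : ℝ} (hx : |x| ≤ 1) :
    |Real.exp x - 1 - x - x ^ 2 / 2| ≤ |x| ^ 3 := by
  have h := Real.exp_bound hx (n := 3) (by norm_num)
  simp only [Finset.sum_range_succ, Finset.sum_range_zero] at h
  norm_num [Nat.factorial] at h
  have e : Real.exp x - 1 - x - x ^ 2 / 2 = Real.exp x - (1 + x + x ^ 2 / 2) := by ring
  rw [e]
  refine h.trans ?_
  have : 0 ≤ |x| ^ 3 := by positivity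
  nlinarith

/-- Third order expansion of a cumulant generating function, with a global remainder bound. -/
lemma abs_log_sum_weight_exp_sub_le (hp : ∀ i, 0 ≤ p i) (hp1 : ∑ i, p i = 1)
    (h : ∀ i, |y i| ≤ r) (hlip : |Real.log (∑ i, p i * Real.exp (y i))| ≤ r) :
    |Real.log (∑ i, p i * Real.exp (y i)) - ∑ i, p i * y i
      - (∑ i, p i * y i ^ 2 - (∑ i, p i * y i) ^ 2) / 2| ≤ 40 * r ^ 3 := by
  have hr : 0 ≤ r := (abs_nonneg _).trans hlip
  set D := ∑ i, p i * y i with hD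
  set Q := ∑ i, p i * y i ^ 2 with hQ
  have hDr : |D| ≤ r := abs_sum_weight_mul_le hp hp1 h
  have hQr : |Q| ≤ r ^ 2 := abs_sum_weight_mul_le hp hp1 fun i => by
    rw [abs_pow]; exact pow_le_pow_left₀ (abs_nonneg _) (h i) 2
  have hD2 : D ^ 2 ≤ r ^ 2 := by rw [← sq_abs D]; exact pow_le_pow_left₀ (abs_nonneg _) hDr 2
  rw [abs_le] at hQr hDr
  -- For small `r` the expansions of `exp` and `log` apply. For `r ≥ 1 / 4` each term is itself `O(r
  -- ^ 3)`: 16 for the logarithm, 16 for the mean, 4 for the variance, whence a constant such as 40.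
  rcases le_total r (1 / 4) with hr4 | hr4
  · set R := ∑ i, p i * (Real.exp (y i) - 1 - y i - y i ^ 2 / 2) with hR
    have hRr : |R| ≤ r ^ 3 := abs_sum_weight_mul_le hp hp1 fun i =>
      (abs_exp_sub_quadratic_le (by linarith [h i])).trans
        (pow_le_pow_left₀ (abs_nonneg _) (h i) 3)
    have e : ∑ i, p i * Real.exp (y i) = 1 + (D + Q / 2 + R) := by
      have e' : ∑ i, p i * Real.exp (y i) = ∑ i, p i + (D + Q / 2 + R) := by
        rw [hD, hQ, hR, Finset.sum_div, ← Finset.sum_add_distrib, ← Finset.sum_add_distrib,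
          ← Finset.sum_add_distrib]
        exact Finset.sum_congr rfl fun i _ => by ring
      rw [e', hp1]
    rw [e]
    set u := D + Q / 2 + R with hu
    rw [abs_le] at hRr
    have hr2 : r ^ 2 ≤ r / 4 := by nlinarith
    have hr3 : r ^ 3 ≤ r ^ 2 / 4 := by nlinarith [sq_nonneg r]
    have hru : |u| ≤ 2 * r := by rw [abs_le]; constructor <;> linarith
    have hlog := abs_log_one_add_sub_le (u := u) (by linarith)
    have hu3 : |u| ^ 3 ≤ 8 * r ^ 3 := by
      calc |u| ^ 3 ≤ (2 * r) ^ 3 := pow_le_pow_left₀ (abs_nonneg _) hru 3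
        _ = 8 * r ^ 3 := by ring
    have huD : |u - D| ≤ r ^ 2 := by rw [abs_le]; constructor <;> linarith
    have huD' : |u + D| ≤ 3 * r := by
      rw [abs_le] at hru ⊢; constructor <;> linarith
    have hsq : |u ^ 2 - D ^ 2| ≤ 3 * r ^ 3 := by
      rw [show u ^ 2 - D ^ 2 = (u - D) * (u + D) by ring, abs_mul]
      calc |u - D| * |u + D| ≤ r ^ 2 * (3 * r) := by gcongr
        _ = 3 * r ^ 3 := by ring
    have e2 : Real.log (1 + u) - D - (Q - D ^ 2) / 2
        = (Real.log (1 + u) - u + u ^ 2 / 2) - (u ^ 2 - D ^ 2) / 2 + R := by rw [hu]; ring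
    rw [e2]
    have h0 : 0 ≤ r ^ 3 := by positivity
    rw [abs_le] at hlog hsq ⊢
    constructor <;> linarith
  · have hr1 : r ≤ 16 * r ^ 3 := by nlinarith [sq_nonneg r, mul_nonneg hr hr]
    have hr2 : r ^ 2 ≤ 4 * r ^ 3 := by nlinarith [sq_nonneg r]
    have := sq_nonneg D
    rw [abs_le] at hlip ⊢
    constructor <;> linarith

end Weights

variable [Nonempty ι]

lemma abs_log_sum_gibbs_exp_le (w y : ι → ℝ) :
    |Real.log (∑ i, gibbs w i * Real.exp (y i))| ≤ ‖y‖ := by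
  rw [← logSumExp_add_sub]
  simpa using abs_logSumExp_sub_le_norm (w + y) w

lemma abs_logSumExp_taylor_three (w y : ι → ℝ) :
    |logSumExp (w + y) - logSumExp w - ∑ i, gibbs w i * y i
      - (∑ i, gibbs w i * y i ^ 2 - (∑ i, gibbs w i * y i) ^ 2) / 2| ≤ 40 * ‖y‖ ^ 3 := by
  rw [logSumExp_add_sub]
  exact abs_log_sum_weight_exp_sub_le (gibbs_nonneg w) (sum_gibbs w)
    (fun i => norm_le_pi_norm y i) (abs_log_sum_gibbs_exp_le w y)

/-- For `‖y‖ ≤ 1` the cubic remainder and the variance term are both absorbed by `‖y‖ ^ 2`; for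
larger `y` the Lipschitz bound is enough. -/
lemma abs_logSumExp_taylor_two (w y : ι → ℝ) :
    |logSumExp (w + y) - logSumExp w - ∑ i, gibbs w i * y i| ≤ 41 * ‖y‖ ^ 2 := by
  have hD : |∑ i, gibbs w i * y i| ≤ ‖y‖ :=
    abs_sum_weight_mul_le (gibbs_nonneg w) (sum_gibbs w) fun i => norm_le_pi_norm y i
  have hQ : |∑ i, gibbs w i * y i ^ 2| ≤ ‖y‖ ^ 2 :=
    abs_sum_weight_mul_le (gibbs_nonneg w) (sum_gibbs w) fun i => by
      rw [abs_pow]; exact pow_le_pow_left₀ (abs_nonneg _) (norm_le_pi_norm y i) 2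
  have hD2 : (∑ i, gibbs w i * y i) ^ 2 ≤ ‖y‖ ^ 2 := by
    rw [← sq_abs]; exact pow_le_pow_left₀ (abs_nonneg _) hD 2
  have hy := norm_nonneg y
  rcases le_total ‖y‖ 1 with h1 | h1
  · have h3 := abs_logSumExp_taylor_three w y
    have : ‖y‖ ^ 3 ≤ ‖y‖ ^ 2 := pow_le_pow_of_le_one hy h1 (by norm_num)
    have := sq_nonneg (∑ i, gibbs w i * y i)
    rw [abs_le] at h3 hQ ⊢
    constructor <;> linarith
  · have h3 := abs_log_sum_gibbs_exp_le w y
    rw [← logSumExp_add_sub] at h3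
    have : ‖y‖ ≤ ‖y‖ ^ 2 := by nlinarith
    rw [abs_le] at h3 hD ⊢
    constructor <;> linarith

end LogSumExp

/-- A function whose increments are at most `L h + C h √h` grows by at most `L` on `[0, 1]`. -/
lemma sub_le_of_forall_increment_le {ψ : ℝ → ℝ} {L C : ℝ}
    (h : ∀ t s : ℝ, 0 ≤ t → 0 < s → t + s ≤ 1 → ψ (t + s) - ψ t ≤ L * s + C * (s * √s)) :
    ψ 1 - ψ 0 ≤ L := by
  -- Over `n + 1` steps of length `s = 1 / (n + 1)` the main terms add up to `L` and the errors to
  -- `C √s`, so no derivative of `ψ` is needed.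
  have key : ∀ n : ℕ, ψ 1 - ψ 0 ≤ L + C * √(1 / ((n : ℝ) + 1)) := by
    intro n
    have hn : (0 : ℝ) < (n : ℝ) + 1 := by positivity
    set s : ℝ := 1 / ((n : ℝ) + 1) with hs
    have hs0 : 0 < s := by positivity
    have hns : ((n : ℝ) + 1) * s = 1 := by rw [hs]; field_simp
    have e := Finset.sum_range_sub (fun k : ℕ => ψ (k * s)) (n + 1)
    simp only [Nat.cast_add, Nat.cast_one, hns, Nat.cast_zero, zero_mul] at e
    rw [← e]
    calc ∑ k ∈ Finset.range (n + 1), (ψ (((k : ℝ) + 1) * s) - ψ (k * s))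
        ≤ ∑ k ∈ Finset.range (n + 1), (L * s + C * (s * √s)) := by
          refine Finset.sum_le_sum fun k hk => ?_
          have hk : (k : ℝ) + 1 ≤ n + 1 := by exact_mod_cast Finset.mem_range.1 hk
          rw [show ((k : ℝ) + 1) * s = k * s + s by ring]
          refine h _ _ (by positivity) hs0 ?_
          rw [← hns, show (k : ℝ) * s + s = (k + 1) * s by ring]
          exact mul_le_mul_of_nonneg_right hk hs0.le
      _ = (((n : ℝ) + 1) * s) * (L + C * √s) := by
          rw [Finset.sum_const, Finset.card_range, nsmul_eq_mul]; push_cast; ring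
      _ = L + C * √s := by rw [hns, one_mul]
  have lim : Tendsto (fun n : ℕ => L + C * √(1 / ((n : ℝ) + 1))) atTop (𝓝 L) := by
    have h0 := (tendsto_one_div_add_atTop_nhds_zero_nat (𝕜 := ℝ)).sqrt.const_mul C |>.const_add L
    simpa using h0
  exact ge_of_tendsto' lim key

/-! ### Centered Gaussian vectors, described by their characteristic functions. -/

section GaussianVector

variable {ι : Type*} [Fintype ι]

/-- The quadratic form of the matrix `C`. -/
def quadForm (C : ι → ι → ℝ) (t : ι → ℝ) : ℝ := ∑ i, ∑ j, t i * t j * C i j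

lemma quadForm_smul (C : ι → ι → ℝ) (s : ℝ) (t : ι → ℝ) :
    quadForm C (fun i => s * t i) = s ^ 2 * quadForm C t := by
  simp only [quadForm, Finset.mul_sum]
  exact Finset.sum_congr rfl fun i _ => Finset.sum_congr rfl fun j _ => by ring

lemma quadForm_single [DecidableEq ι] (C : ι → ι → ℝ) (i : ι) :
    quadForm C (Pi.single i 1) = C i i := by
  rw [quadForm, Finset.sum_eq_single i, Finset.sum_eq_single i]
  · simp
  · intro j _ hj; simp [hj]
  · simp
  · intro j _ hj; simp [hj]
  · simp

lemma quadForm_le {C : ι → ι → ℝ} {L : ℝ} (hC : ∀ i j, C i j ≤ L) {p : ι → ℝ}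
    (hp : ∀ i, 0 ≤ p i) (hp1 : ∑ i, p i = 1) : quadForm C p ≤ L := by
  calc quadForm C p ≤ ∑ i, ∑ j, p i * p j * L :=
        Finset.sum_le_sum fun i _ => Finset.sum_le_sum fun j _ =>
          mul_le_mul_of_nonneg_left (hC i j) (mul_nonneg (hp i) (hp j))
    _ = L := by
        simp only [← Finset.sum_mul, ← Finset.mul_sum, hp1, mul_one, one_mul]

/-- `μ` is the law of a centered Gaussian vector with covariance matrix `C`. -/
structure IsCenteredGaussian (μ : Measure (ι → ℝ)) (C : ι → ι → ℝ) : Prop where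
  isProbabilityMeasure : IsProbabilityMeasure μ
  integral_exp : ∀ t : ι → ℝ,
    ∫ x, Complex.exp (((∑ i, t i * x i : ℝ) : ℂ) * Complex.I) ∂μ =
      ((Real.exp (-quadForm C t / 2) : ℝ) : ℂ)

/-- The linear form with coefficients `t`. -/
def dotForm (t : ι → ℝ) : StrongDual ℝ (ι → ℝ) :=
  ∑ i, t i • ContinuousLinearMap.proj (R := ℝ) (φ := fun _ : ι => ℝ) i

lemma dotForm_apply (t x : ι → ℝ) : dotForm t x = ∑ i, t i * x i := by
  simp [dotForm]

lemma exists_dotForm_eq (L : StrongDual ℝ (ι → ℝ)) : ∃ t, L = dotForm t := by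
  classical
  refine ⟨fun i => L (Pi.single i 1), ?_⟩
  ext x
  conv_lhs => rw [pi_eq_sum_univ' x, map_sum]
  rw [dotForm_apply]
  refine Finset.sum_congr rfl fun i _ => ?_
  rw [map_smul, smul_eq_mul, mul_comm]

namespace IsCenteredGaussian

variable {μ ν : Measure (ι → ℝ)} {C D : ι → ι → ℝ}

lemma charFunDual_dotForm (h : IsCenteredGaussian μ C) (t : ι → ℝ) :
    charFunDual μ (dotForm t) = ((Real.exp (-quadForm C t / 2) : ℝ) : ℂ) := by
  rw [charFunDual_apply, ← h.integral_exp t]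
  simp only [dotForm_apply]

lemma mk_of_charFunDual [IsProbabilityMeasure μ]
    (h : ∀ t, charFunDual μ (dotForm t) = ((Real.exp (-quadForm C t / 2) : ℝ) : ℂ)) :
    IsCenteredGaussian μ C := by
  refine ⟨inferInstance, fun t => ?_⟩
  rw [← h, charFunDual_apply]
  simp only [dotForm_apply]

lemma congr (h : IsCenteredGaussian μ C) (hCD : ∀ i j, C i j = D i j) :
    IsCenteredGaussian μ D := by
  rwa [← show C = D from funext fun i => funext fun j => hCD i j]

lemma unique (h : IsCenteredGaussian μ C) (h' : IsCenteredGaussian ν C) : μ = ν := by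
  have := h.1
  have := h'.1
  refine Measure.ext_of_charFunDual (funext fun L => ?_)
  obtain ⟨t, rfl⟩ := exists_dotForm_eq L
  rw [h.charFunDual_dotForm, h'.charFunDual_dotForm]

lemma conv (h : IsCenteredGaussian μ C) (h' : IsCenteredGaussian ν D) :
    IsCenteredGaussian (μ ∗ ν) (fun i j => C i j + D i j) := by
  have := h.1
  have := h'.1
  refine mk_of_charFunDual fun t => ?_
  rw [charFunDual_conv, h.charFunDual_dotForm, h'.charFunDual_dotForm, ← Complex.ofReal_mul,
    ← Real.exp_add]
  congr 2
  simp only [quadForm, mul_add, Finset.sum_add_distrib]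
  ring

/-- The characteristic function of the image at `t` is that of `μ` at `t ∘ T`. Stating `hT` through
the coefficients `s` of this form avoids writing the matrix of `T`. -/
lemma map_linear {κ : Type*} [Fintype κ] (h : IsCenteredGaussian μ C)
    (T : (ι → ℝ) →L[ℝ] (κ → ℝ)) {D : κ → κ → ℝ}
    (hT : ∀ t s, (dotForm t).comp T = dotForm s → quadForm C s = quadForm D t) :
    IsCenteredGaussian (μ.map T) D := by
  have := h.1
  have : IsProbabilityMeasure (μ.map T) := Measure.isProbabilityMeasure_map (by fun_prop)
  refine mk_of_charFunDual fun t => ?_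
  obtain ⟨s, hs⟩ := exists_dotForm_eq ((dotForm t).comp T)
  rw [charFunDual_map, hs, h.charFunDual_dotForm, hT t s hs]

lemma dotForm_injective {t s : ι → ℝ} (h : dotForm t = dotForm s) : t = s := by
  classical
  funext i
  have := congrArg (fun L : StrongDual ℝ (ι → ℝ) => L (Pi.single i 1)) h
  simpa [dotForm_apply, Pi.single_apply] using this

lemma map_smul (h : IsCenteredGaussian μ C) (s : ℝ) :
    IsCenteredGaussian (μ.map fun x => s • x) (fun i j => s ^ 2 * C i j) := by
  refine h.map_linear (s • ContinuousLinearMap.id ℝ (ι → ℝ)) fun t u htu => ?_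
  have : u = fun i => s * t i := by
    refine dotForm_injective (htu.symm.trans ?_)
    ext x
    simp only [ContinuousLinearMap.comp_apply, smul_apply,
      ContinuousLinearMap.id_apply, dotForm_apply, Pi.smul_apply, smul_eq_mul]
    exact Finset.sum_congr rfl fun i _ => by ring
  rw [this, quadForm_smul]
  simp only [quadForm, Finset.mul_sum]
  exact Finset.sum_congr rfl fun i _ => Finset.sum_congr rfl fun j _ => by ring

/-- A characteristic function has modulus at most 1, so positivity of `C` need not be assumed in
`IsCenteredGaussian`. -/
lemma quadForm_nonneg (h : IsCenteredGaussian μ C) (t : ι → ℝ) : 0 ≤ quadForm C t := by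
  have := h.1
  have : IsProbabilityMeasure (μ.map (dotForm t)) :=
    Measure.isProbabilityMeasure_map (by fun_prop)
  have h1 := norm_charFun_le_one (μ := μ.map (dotForm t)) 1
  rw [← charFunDual_eq_charFun_map_one, h.charFunDual_dotForm, Complex.norm_real,
    Real.norm_eq_abs, Real.abs_exp, Real.exp_le_one_iff] at h1
  linarith

lemma map_dotForm (h : IsCenteredGaussian μ C) (t : ι → ℝ) :
    μ.map (dotForm t) = gaussianReal 0 (quadForm C t).toNNReal := by
  have := h.1
  refine Measure.ext_of_charFun (funext fun s => ?_)
  rw [charFun_map_eq_charFunDual_smul, charFun_gaussianReal]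
  have : s • dotForm t = dotForm fun i => s * t i := by
    ext x
    simp only [smul_apply, dotForm_apply, smul_eq_mul, Finset.mul_sum]
    exact Finset.sum_congr rfl fun i _ => by ring
  rw [this, h.charFunDual_dotForm, quadForm_smul]
  rw [Real.coe_toNNReal _ (h.quadForm_nonneg t)]
  push_cast
  congr 1
  ring

lemma isGaussian (h : IsCenteredGaussian μ C) : IsGaussian μ := by
  refine isGaussian_of_map_eq_gaussianReal fun L => ?_
  obtain ⟨t, rfl⟩ := exists_dotForm_eq L
  exact ⟨_, _, h.map_dotForm t⟩

lemma integrable_norm_pow (h : IsCenteredGaussian μ C) (k : ℕ) :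
    Integrable (fun x => ‖x‖ ^ k) μ := by
  have := h.isGaussian
  rcases Nat.eq_zero_or_pos k with rfl | hk
  · simp
  · exact (IsGaussian.memLp_id μ k (by simp)).integrable_norm_pow hk.ne'

lemma integrable_norm (h : IsCenteredGaussian μ C) : Integrable (fun x => ‖x‖) μ := by
  simpa using h.integrable_norm_pow 1

lemma integrable_of_abs_le (h : IsCenteredGaussian μ C) {f : (ι → ℝ) → ℝ} (hf : Continuous f)
    {a b : ℝ} {k : ℕ} (hb : ∀ x, |f x| ≤ a + b * ‖x‖ ^ k) : Integrable f μ := by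
  have := h.1
  exact ((integrable_const a).add ((h.integrable_norm_pow k).const_mul b)).mono'
    hf.aestronglyMeasurable (ae_of_all _ hb)

lemma integral_dotForm (h : IsCenteredGaussian μ C) (t : ι → ℝ) :
    ∫ x, ∑ i, t i * x i ∂μ = 0 := by
  have e := integral_map (μ := μ) (φ := dotForm t) (f := fun x : ℝ => x)
    (by fun_prop) (by fun_prop)
  rw [h.map_dotForm, integral_id_gaussianReal] at e
  simpa only [dotForm_apply] using e.symm

lemma integrable_dotForm (h : IsCenteredGaussian μ C) (t : ι → ℝ) :
    Integrable (fun x => ∑ i, t i * x i) μ := by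
  have := h.isGaussian
  exact (IsGaussian.integrable_dual μ (dotForm t)).congr
    (ae_of_all _ fun x => dotForm_apply t x)

lemma integrable_dotForm_sq (h : IsCenteredGaussian μ C) (t : ι → ℝ) :
    Integrable (fun x => (∑ i, t i * x i) ^ 2) μ := by
  have := h.isGaussian
  simpa only [dotForm_apply] using (IsGaussian.memLp_dual μ (dotForm t) 2 (by simp)).integrable_sq

lemma integral_dotForm_sq (h : IsCenteredGaussian μ C) (t : ι → ℝ) :
    ∫ x, (∑ i, t i * x i) ^ 2 ∂μ = quadForm C t := by
  have e := integral_map (μ := μ) (φ := dotForm t) (f := fun x : ℝ => x ^ 2)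
    (by fun_prop) (by fun_prop)
  have e2 := variance_fun_id_gaussianReal (μ := 0) (v := (quadForm C t).toNNReal)
  rw [variance_of_integral_eq_zero (by fun_prop) integral_id_gaussianReal] at e2
  rw [h.map_dotForm, e2, Real.coe_toNNReal _ (h.quadForm_nonneg t)] at e
  simpa only [dotForm_apply] using e.symm

lemma integrable_sq (h : IsCenteredGaussian μ C) (i : ι) : Integrable (fun x => x i ^ 2) μ := by
  classical
  have := h.integrable_dotForm_sq (Pi.single i 1)
  simpa [Pi.single_apply] using this

lemma integral_sq (h : IsCenteredGaussian μ C) (i : ι) : ∫ x, x i ^ 2 ∂μ = C i i := by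
  classical
  have := h.integral_dotForm_sq (Pi.single i 1)
  rw [quadForm_single] at this
  simpa [Pi.single_apply] using this

lemma map_rotation (h : IsCenteredGaussian μ C) (θ : ℝ) :
    (μ.prod μ).map (ContinuousLinearMap.rotation θ) = μ.prod μ := by
  have := h.isGaussian
  refine IsGaussian.map_rotation_eq_self_of_forall_strongDual_eq_zero (fun L => ?_) θ
  obtain ⟨t, rfl⟩ := exists_dotForm_eq L
  simpa only [dotForm_apply] using h.integral_dotForm t

end IsCenteredGaussian

end GaussianVector

/-! ### Gaussian comparison by interpolation. -/

section GaussianFreeEnergy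

variable {ι : Type*} [Fintype ι] [Nonempty ι] {μ ν : Measure (ι → ℝ)} {C D : ι → ι → ℝ}

lemma abs_logSumExp_le (w x : ι → ℝ) : |logSumExp (w + x)| ≤ |logSumExp w| + ‖x‖ := by
  have h := abs_logSumExp_sub_le_norm (w + x) w
  rw [add_sub_cancel_left] at h
  have := abs_sub_abs_le_abs_sub (logSumExp (w + x)) (logSumExp w)
  linarith

lemma continuous_logSumExp_add (w : ι → ℝ) : Continuous fun x => logSumExp (w + x) :=
  continuous_logSumExp.comp (by fun_prop)

lemma IsCenteredGaussian.integrable_logSumExp (h : IsCenteredGaussian μ C) (w : ι → ℝ) :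
    Integrable (fun x => logSumExp (w + x)) μ :=
  h.integrable_of_abs_le (continuous_logSumExp_add w) (a := |logSumExp w|) (b := 1) (k := 1)
    fun x => by simpa using abs_logSumExp_le w x

lemma IsCenteredGaussian.integrable_logSumExp_smul (h : IsCenteredGaussian μ C) (w : ι → ℝ)
    (s : ℝ) : Integrable (fun x => logSumExp (w + s • x)) μ :=
  h.integrable_of_abs_le (continuous_logSumExp.comp (by fun_prop)) (a := |logSumExp w|)
    (b := |s|) (k := 1) fun x => by simpa [norm_smul] using abs_logSumExp_le w (s • x)

/-- Second order expansion of the Gaussian free energy in the size of the Gaussian vector. -/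
lemma IsCenteredGaussian.abs_integral_logSumExp_smul_sub_le (h : IsCenteredGaussian μ C)
    (w : ι → ℝ) {s : ℝ} (hs : 0 ≤ s) :
    |∫ x, logSumExp (w + s • x) ∂μ - logSumExp w
      - s ^ 2 / 2 * (∑ i, gibbs w i * C i i - quadForm C (gibbs w))|
      ≤ s ^ 3 * (40 * ∫ x, ‖x‖ ^ 3 ∂μ) := by
  have := h.1
  have i1 := h.integrable_logSumExp_smul w s
  have i2 : Integrable (fun _ : ι → ℝ => logSumExp w) μ := integrable_const _
  have i3 := (h.integrable_dotForm (gibbs w)).const_mul s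
  have i4 : Integrable (fun x => ∑ i, gibbs w i * x i ^ 2) μ :=
    integrable_finsetSum _ fun i _ => (h.integrable_sq i).const_mul _
  have i5 := h.integrable_dotForm_sq (gibbs w)
  have i6 : Integrable (fun x => s ^ 2 / 2 *
      (∑ i, gibbs w i * x i ^ 2 - (∑ i, gibbs w i * x i) ^ 2)) μ := (i4.sub i5).const_mul _
  have i7 : Integrable (fun x => logSumExp (w + s • x) - logSumExp w) μ := i1.sub i2
  have i8 : Integrable (fun x => logSumExp (w + s • x) - logSumExp w
      - s * ∑ i, gibbs w i * x i) μ := i7.sub i3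
  -- The linear term has mean zero, and the quadratic one averages to the covariances under the
  -- Gibbs weights.
  have e : ∫ x, (logSumExp (w + s • x) - logSumExp w - s * ∑ i, gibbs w i * x i
      - s ^ 2 / 2 * (∑ i, gibbs w i * x i ^ 2 - (∑ i, gibbs w i * x i) ^ 2)) ∂μ
      = ∫ x, logSumExp (w + s • x) ∂μ - logSumExp w
      - s ^ 2 / 2 * (∑ i, gibbs w i * C i i - quadForm C (gibbs w)) := by
    rw [integral_sub i8 i6, integral_sub i7 i3, integral_sub i1 i2,
      integral_const_mul, integral_const_mul, h.integral_dotForm, integral_sub i4 i5,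
      h.integral_dotForm_sq, integral_finsetSum _ fun i _ => (h.integrable_sq i).const_mul _]
    simp only [integral_const_mul, h.integral_sq]
    simp
  rw [← e, ← Real.norm_eq_abs, ← integral_const_mul, ← integral_const_mul]
  refine norm_integral_le_of_norm_le (((h.integrable_norm_pow 3).const_mul 40).const_mul _)
    (ae_of_all _ fun x => ?_)
  have ht := abs_logSumExp_taylor_three w (s • x)
  rw [norm_smul, Real.norm_of_nonneg hs] at ht
  have e1 : ∑ i, gibbs w i * (s • x) i = s * ∑ i, gibbs w i * x i := by
    rw [Finset.mul_sum]
    exact Finset.sum_congr rfl fun i _ => by rw [Pi.smul_apply, smul_eq_mul]; ring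
  have e2 : ∑ i, gibbs w i * (s • x) i ^ 2 = s ^ 2 * ∑ i, gibbs w i * x i ^ 2 := by
    rw [Finset.mul_sum]
    exact Finset.sum_congr rfl fun i _ => by rw [Pi.smul_apply, smul_eq_mul]; ring
  rw [e1, e2] at ht
  rw [Real.norm_eq_abs]
  refine (le_of_eq ?_).trans (ht.trans (le_of_eq (by ring)))
  congr 1
  ring

omit [Nonempty ι] in
lemma integrable_integral_add_of_conv [IsProbabilityMeasure μ] [IsProbabilityMeasure ν]
    {F : (ι → ℝ) → ℝ} (hF : Integrable F (μ ∗ ν)) :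
    Integrable (fun x => ∫ y, F (x + y) ∂ν) μ := by
  have h := (integrable_map_measure (f := fun x : (ι → ℝ) × (ι → ℝ) => x.1 + x.2)
    (μ := μ.prod ν) hF.1 (by fun_prop)).mp hF
  exact h.integral_prod_left

/-- Gaussian comparison for the free energy: with equal variances, larger covariances lower the
free energy. -/
theorem IsCenteredGaussian.integral_logSumExp_anti (hμ : IsCenteredGaussian μ C)
    (hν : IsCenteredGaussian ν D) (hdiag : ∀ i, C i i = D i i) (hle : ∀ i j, C i j ≤ D i j)
    (c : ι → ℝ) : ∫ x, logSumExp (c + x) ∂ν ≤ ∫ x, logSumExp (c + x) ∂μ := by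
  have pμ := hμ.1
  have pν := hν.1
  -- The law of `√a X + √b Y` with `X`, `Y` independent; the interpolation runs along `a = t`, `b =
  -- 1 - t`.
  let θ : ℝ → ℝ → Measure (ι → ℝ) := fun a b => (μ.map fun x => √a • x) ∗ (ν.map fun x => √b • x)
  have hθ : ∀ a b, 0 ≤ a → 0 ≤ b →
      IsCenteredGaussian (θ a b) (fun i j => a * C i j + b * D i j) := by
    intro a b ha hb
    refine ((hμ.map_smul √a).conv (hν.map_smul √b)).congr fun i j => ?_
    rw [Real.sq_sqrt ha, Real.sq_sqrt hb]
  let K : ℝ := 40 * ∫ x, ‖x‖ ^ 3 ∂μ + 40 * ∫ x, ‖x‖ ^ 3 ∂ν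
  have h := sub_le_of_forall_increment_le
    (ψ := fun t => -∫ x, logSumExp (c + x) ∂(θ t (1 - t))) (L := 0) (C := K) ?_
  · have e1 : θ 1 (1 - 1) = μ := (hθ 1 (1 - 1) (by norm_num) (by norm_num)).unique
      (hμ.congr fun i j => by ring)
    have e0 : θ 0 (1 - 0) = ν := (hθ 0 (1 - 0) (by norm_num) (by norm_num)).unique
      (hν.congr fun i j => by ring)
    simp only [e1, e0] at h
    linarith
  · intro t s ht hs hts
    -- The laws at times `t` and `t + s` share the part `ρ`. They differ only in an independent
    -- increment of scale `√s`, drawn from `ν` and from `μ` respectively.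
    have hρ := hθ t (1 - t - s) ht (by linarith)
    set ρ := θ t (1 - t - s)
    have pρ := hρ.1
    have gμ := hμ.map_smul √s
    have gν := hν.map_smul √s
    have p1 := gμ.1
    have p2 := gν.1
    have c1 : θ (t + s) (1 - (t + s)) = ρ ∗ (μ.map fun x => √s • x) := by
      refine (hθ _ _ (by linarith) (by linarith)).unique ((hρ.conv gμ).congr fun i j => ?_)
      rw [Real.sq_sqrt hs.le]; ring
    have c2 : θ t (1 - t) = ρ ∗ (ν.map fun x => √s • x) := by
      refine (hθ _ _ (by linarith) (by linarith)).unique ((hρ.conv gν).congr fun i j => ?_)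
      rw [Real.sq_sqrt hs.le]; ring
    have j1 := (hρ.conv gμ).integrable_logSumExp c
    have j2 := (hρ.conv gν).integrable_logSumExp c
    simp only [c1, c2, zero_mul, zero_add]
    rw [integral_conv j1, integral_conv j2, neg_sub_neg,
      ← integral_sub (integrable_integral_add_of_conv j2) (integrable_integral_add_of_conv j1)]
    have hpt : ∀ w, ∫ y, logSumExp (c + (w + y)) ∂(ν.map fun x => √s • x)
        - ∫ y, logSumExp (c + (w + y)) ∂(μ.map fun x => √s • x) ≤ K * (s * √s) := by
      intro w
      have m (κ : Measure (ι → ℝ)) : ∫ y, logSumExp (c + (w + y)) ∂(κ.map fun x => √s • x)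
          = ∫ y, logSumExp (c + w + √s • y) ∂κ := by
        simp only [← add_assoc]
        exact integral_map (by fun_prop) (continuous_logSumExp_add _).aestronglyMeasurable
      rw [m, m]
      have t1 := hμ.abs_integral_logSumExp_smul_sub_le (c + w) (Real.sqrt_nonneg s)
      have t2 := hν.abs_integral_logSumExp_smul_sub_le (c + w) (Real.sqrt_nonneg s)
      have hq : quadForm C (gibbs (c + w)) ≤ quadForm D (gibbs (c + w)) :=
        Finset.sum_le_sum fun i _ => Finset.sum_le_sum fun j _ =>
          mul_le_mul_of_nonneg_left (hle i j) (mul_nonneg (gibbs_nonneg _ _) (gibbs_nonneg _ _))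
      -- Equal variances cancel at order `s`. What remains is the difference of the quadratic forms,
      -- whose sign is `hq`, and cubic errors of order `s √s`.
      have hd : ∑ i, gibbs (c + w) i * C i i = ∑ i, gibbs (c + w) i * D i i := by
        simp only [hdiag]
      have e3 : √s ^ 3 = s * √s := by rw [pow_succ, Real.sq_sqrt hs.le]
      rw [Real.sq_sqrt hs.le, e3] at t1 t2
      rw [hd] at t1
      have hsq := mul_le_mul_of_nonneg_left hq (by linarith : 0 ≤ s / 2)
      rw [abs_le] at t1 t2
      have hK : K * (s * √s) = s * √s * (40 * ∫ x, ‖x‖ ^ 3 ∂μ)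
        + s * √s * (40 * ∫ x, ‖x‖ ^ 3 ∂ν) := by ring
      linarith [t1.1, t2.2]
    calc _ ≤ ∫ _, K * (s * √s) ∂ρ := integral_mono
          ((integrable_integral_add_of_conv j2).sub (integrable_integral_add_of_conv j1))
          (integrable_const _) hpt
      _ = K * (s * √s) := by simp

end GaussianFreeEnergy

/-! ### Concentration in `L¹` by Gaussian rotation. -/

section Concentration

variable {ι : Type*} [Fintype ι] [Nonempty ι] {μ : Measure (ι → ℝ)} {C : ι → ι → ℝ}

lemma continuous_gibbs (i : ι) : Continuous fun x : ι → ℝ => gibbs x i := by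
  unfold gibbs
  exact Continuous.div (by fun_prop) (by fun_prop) fun x => (sum_exp_pos x).ne'

lemma abs_sum_gibbs_mul_le (w y : ι → ℝ) : |∑ i, gibbs w i * y i| ≤ ‖y‖ :=
  abs_sum_weight_mul_le (gibbs_nonneg w) (sum_gibbs w) fun i => norm_le_pi_norm y i

/-- As `cos δ - 1 = O(δ ^ 2)`, the motion is `δ x'` to first order, so only the gradient paired with
`x'` enters at order `δ`. The bound `δ ≤ 2` serves to get `δ ^ 2 / 2 ≤ δ`. -/
lemma abs_logSumExp_rotate_sub_le (c x x' : ι → ℝ) {δ : ℝ} (hδ : 0 ≤ δ) (hδ2 : δ ≤ 2) :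
    |logSumExp (c + (Real.cos δ • x + Real.sin δ • x')) - logSumExp (c + x)|
      ≤ δ * |∑ i, gibbs (c + x) i * x' i|
        + δ ^ 2 * (‖x‖ / 2 + 82 * (‖x‖ ^ 2 + ‖x'‖ ^ 2)) := by
  set a := Real.cos δ - 1 with ha
  have ha' : |a| ≤ δ ^ 2 / 2 := by
    rw [abs_le]
    constructor
    · linarith [Real.one_sub_sq_div_two_le_cos (x := δ)]
    · linarith [Real.cos_le_one δ, sq_nonneg δ]
  have hb : |Real.sin δ| ≤ δ := (Real.abs_sin_le_abs).trans (abs_of_nonneg hδ).le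
  set b := Real.sin δ
  have hx := norm_nonneg x
  have hx' := norm_nonneg x'
  have e : c + (Real.cos δ • x + b • x') = c + x + (a • x + b • x') := by
    rw [ha, sub_smul, one_smul]; abel
  rw [e]
  have ht := abs_logSumExp_taylor_two (c + x) (a • x + b • x')
  have es : ∑ i, gibbs (c + x) i * (a • x + b • x') i
      = a * ∑ i, gibbs (c + x) i * x i + b * ∑ i, gibbs (c + x) i * x' i := by
    rw [Finset.mul_sum, Finset.mul_sum, ← Finset.sum_add_distrib]
    refine Finset.sum_congr rfl fun i _ => ?_
    simp only [Pi.add_apply, Pi.smul_apply, smul_eq_mul]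
    ring
  have hn : ‖a • x + b • x'‖ ≤ δ * (‖x‖ + ‖x'‖) := by
    refine (norm_add_le _ _).trans ?_
    rw [norm_smul, norm_smul, Real.norm_eq_abs, Real.norm_eq_abs, mul_add]
    have h1 : |a| ≤ δ := by nlinarith
    gcongr
  have hn2 : ‖a • x + b • x'‖ ^ 2 ≤ δ ^ 2 * (2 * (‖x‖ ^ 2 + ‖x'‖ ^ 2)) := by
    calc ‖a • x + b • x'‖ ^ 2 ≤ (δ * (‖x‖ + ‖x'‖)) ^ 2 := by gcongr
      _ = δ ^ 2 * (‖x‖ + ‖x'‖) ^ 2 := by ring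
      _ ≤ δ ^ 2 * (2 * (‖x‖ ^ 2 + ‖x'‖ ^ 2)) := by
        gcongr; nlinarith [sq_nonneg (‖x‖ - ‖x'‖)]
  have h1 : |a * ∑ i, gibbs (c + x) i * x i| ≤ δ ^ 2 / 2 * ‖x‖ := by
    rw [abs_mul]
    exact mul_le_mul ha' (abs_sum_gibbs_mul_le _ _) (abs_nonneg _) (by positivity)
  have h2 : |b * ∑ i, gibbs (c + x) i * x' i| ≤ δ * |∑ i, gibbs (c + x) i * x' i| := by
    rw [abs_mul]
    gcongr
  rw [es] at ht
  rw [abs_le] at ht h1 h2 ⊢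
  constructor <;> linarith

namespace IsCenteredGaussian

/-- Given `z.1`, the sum is a linear form in an independent Gaussian vector. Its variance is an
average of entries of `C` under probability weights, hence at most `s ^ 2`. -/
lemma integral_abs_sum_gibbs_le (h : IsCenteredGaussian μ C) {s : ℝ} (hs : 0 < s)
    (hC : ∀ i j, C i j ≤ s ^ 2) (c : ι → ℝ) :
    Integrable (fun z : (ι → ℝ) × (ι → ℝ) => |∑ i, gibbs (c + z.1) i * z.2 i|) (μ.prod μ) ∧
    ∫ z, |∑ i, gibbs (c + z.1) i * z.2 i| ∂(μ.prod μ) ≤ s := by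
  have := h.1
  have hcont : Continuous fun z : (ι → ℝ) × (ι → ℝ) => ∑ i, gibbs (c + z.1) i * z.2 i :=
    continuous_finsetSum _ fun i _ => ((continuous_gibbs i).comp (by fun_prop)).mul (by fun_prop)
  have i1 : Integrable (fun z : (ι → ℝ) × (ι → ℝ) => |∑ i, gibbs (c + z.1) i * z.2 i|)
      (μ.prod μ) :=
    (h.integrable_norm.comp_snd μ).mono' hcont.abs.aestronglyMeasurable
      (ae_of_all _ fun z => by simpa using abs_sum_gibbs_mul_le (c + z.1) z.2)
  have i2 : Integrable (fun z : (ι → ℝ) × (ι → ℝ) => (∑ i, gibbs (c + z.1) i * z.2 i) ^ 2)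
      (μ.prod μ) := by
    refine ((h.integrable_norm_pow 2).comp_snd μ).mono' (hcont.pow 2).aestronglyMeasurable
      (ae_of_all _ fun z => ?_)
    rw [Real.norm_eq_abs, abs_pow]
    exact pow_le_pow_left₀ (abs_nonneg _) (abs_sum_gibbs_mul_le (c + z.1) z.2) 2
  refine ⟨i1, ?_⟩
  have hsq : ∫ z, (∑ i, gibbs (c + z.1) i * z.2 i) ^ 2 ∂(μ.prod μ) ≤ s ^ 2 := by
    rw [integral_prod _ i2]
    simp only [h.integral_dotForm_sq]
    have hi : Integrable (fun x => quadForm C (gibbs (c + x))) μ := by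
      have := i2.integral_prod_left
      simpa only [h.integral_dotForm_sq] using this
    calc ∫ x, quadForm C (gibbs (c + x)) ∂μ ≤ ∫ _, s ^ 2 ∂μ :=
          integral_mono hi (integrable_const _) fun x =>
            quadForm_le hC (gibbs_nonneg _) (sum_gibbs _)
      _ = s ^ 2 := by simp
  calc ∫ z, |∑ i, gibbs (c + z.1) i * z.2 i| ∂(μ.prod μ)
      ≤ ∫ z, ((2 * s)⁻¹ * (∑ i, gibbs (c + z.1) i * z.2 i) ^ 2 + s / 2) ∂(μ.prod μ) := by
        refine integral_mono i1 ((i2.const_mul _).add (integrable_const _)) fun z => ?_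
        set u := ∑ i, gibbs (c + z.1) i * z.2 i
        change |u| ≤ (2 * s)⁻¹ * u ^ 2 + s / 2
        -- AM–GM stands in for Cauchy–Schwarz; with this weight both halves contribute `s / 2`.
        have e : (2 * s)⁻¹ * u ^ 2 + s / 2 - |u| = (2 * s)⁻¹ * (|u| - s) ^ 2 := by
          rw [← sq_abs u]; field_simp; ring
        have : 0 ≤ (2 * s)⁻¹ * (|u| - s) ^ 2 := by positivity
        linarith
    _ = (2 * s)⁻¹ * ∫ z, (∑ i, gibbs (c + z.1) i * z.2 i) ^ 2 ∂(μ.prod μ) + s / 2 := by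
        rw [integral_add (i2.const_mul _) (integrable_const _), integral_const_mul]
        simp
    _ ≤ (2 * s)⁻¹ * s ^ 2 + s / 2 := by gcongr
    _ = s := by field_simp; ring

/-- A quarter turn carries `z.1` to `z.2`. The product law is rotation invariant, so every small
turn costs the same, `δ s + O(δ ^ 2)`; summing and refining leaves `π / 2 * s`. -/
lemma integral_abs_logSumExp_prod_le (h : IsCenteredGaussian μ C) {s : ℝ} (hs : 0 < s)
    (hC : ∀ i j, C i j ≤ s ^ 2) (c : ι → ℝ) :
    ∫ z, |logSumExp (c + z.2) - logSumExp (c + z.1)| ∂(μ.prod μ) ≤ Real.pi / 2 * s := by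
  have := h.1
  obtain ⟨j1, j2⟩ := h.integral_abs_sum_gibbs_le hs hC c
  let V : ℝ → (ι → ℝ) × (ι → ℝ) → ℝ := fun θ z =>
    logSumExp (c + (Real.cos θ • z.1 + Real.sin θ • z.2))
  have hV : ∀ θ, Continuous (V θ) := fun θ => (continuous_logSumExp_add c).comp (by fun_prop)
  let G : (ι → ℝ) × (ι → ℝ) → ℝ := fun z => ‖z.1‖ / 2 + 82 * (‖z.1‖ ^ 2 + ‖z.2‖ ^ 2)
  have hG : Integrable G (μ.prod μ) :=
    ((h.integrable_norm.comp_fst μ).div_const 2).add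
      ((((h.integrable_norm_pow 2).comp_fst μ).add
        ((h.integrable_norm_pow 2).comp_snd μ)).const_mul 82)
  set M := ∫ z, G z ∂(μ.prod μ)
  have hstep0 : ∀ δ, 0 ≤ δ → δ ≤ 2 → Integrable (fun z => |V δ z - V 0 z|) (μ.prod μ) ∧
      ∫ z, |V δ z - V 0 z| ∂(μ.prod μ) ≤ δ * s + δ ^ 2 * M := by
    intro δ h0 h2
    have hb : ∀ z, |V δ z - V 0 z| ≤ δ * |∑ i, gibbs (c + z.1) i * z.2 i| + δ ^ 2 * G z := by
      intro z
      simpa [V, G] using abs_logSumExp_rotate_sub_le c z.1 z.2 h0 h2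
    have hi := (j1.const_mul δ).add (hG.const_mul (δ ^ 2))
    have hi1 : Integrable (fun z => |V δ z - V 0 z|) (μ.prod μ) :=
      hi.mono' ((hV δ).sub (hV 0)).abs.aestronglyMeasurable
        (ae_of_all _ fun z => by simpa using hb z)
    refine ⟨hi1, (integral_mono hi1 hi hb).trans ?_⟩
    simp only [Pi.add_apply]
    rw [integral_add (j1.const_mul δ) (hG.const_mul (δ ^ 2)), integral_const_mul,
      integral_const_mul]
    gcongr
  have hrot : ∀ θ δ z, V (θ + δ) z = V δ (ContinuousLinearMap.rotation θ z) := by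
    intro θ δ z
    simp only [V, ContinuousLinearMap.rotation_apply, Real.cos_add, Real.sin_add]
    congr 2
    module
  have hstep : ∀ θ δ, 0 ≤ δ → δ ≤ 2 →
      Integrable (fun z => |V (θ + δ) z - V θ z|) (μ.prod μ) ∧
      ∫ z, |V (θ + δ) z - V θ z| ∂(μ.prod μ) ≤ δ * s + δ ^ 2 * M := by
    intro θ δ h0 h2
    obtain ⟨k1, k2⟩ := hstep0 δ h0 h2
    have e : (fun z => |V (θ + δ) z - V θ z|)
        = (fun z => |V δ z - V 0 z|) ∘ ContinuousLinearMap.rotation θ := by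
      funext z
      simp only [Function.comp, ← hrot, add_zero]
    have hc : Continuous fun z => |V δ z - V 0 z| := ((hV δ).sub (hV 0)).abs
    have k1' := k1
    have k2' := k2
    rw [← h.map_rotation θ] at k1' k2'
    rw [integral_map (by fun_prop) hc.aestronglyMeasurable] at k2'
    rw [e]
    refine ⟨(integrable_map_measure hc.aestronglyMeasurable
      (by fun_prop)).mp k1', ?_⟩
    exact k2'
  have key : ∀ n : ℕ, ∫ z, |V (Real.pi / 2) z - V 0 z| ∂(μ.prod μ)
      ≤ Real.pi / 2 * s + (Real.pi / 2) ^ 2 * M * (1 / ((n : ℝ) + 1)) := by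
    intro n
    have hn : (0 : ℝ) < (n : ℝ) + 1 := by positivity
    set δ : ℝ := Real.pi / 2 / ((n : ℝ) + 1) with hδ
    have hδ0 : 0 ≤ δ := by positivity
    have hδ2 : δ ≤ 2 := by
      rw [hδ, div_le_iff₀ hn]
      have : (0 : ℝ) ≤ n := by positivity
      linarith [Real.pi_le_four]
    have hnδ : ((n : ℝ) + 1) * δ = Real.pi / 2 := by rw [hδ]; field_simp
    have hi : ∀ k : ℕ, Integrable (fun z => |V ((k : ℝ) * δ + δ) z - V (k * δ) z|) (μ.prod μ) :=
      fun k => (hstep _ _ hδ0 hδ2).1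
    have hpt : ∀ z, |V (Real.pi / 2) z - V 0 z|
        ≤ ∑ k ∈ Finset.range (n + 1), |V ((k : ℝ) * δ + δ) z - V (k * δ) z| := by
      intro z
      have e := Finset.sum_range_sub (fun k : ℕ => V (k * δ) z) (n + 1)
      simp only [Nat.cast_add, Nat.cast_one, hnδ, Nat.cast_zero, zero_mul] at e
      simp only [add_mul, one_mul] at e
      rw [← e]
      exact Finset.abs_sum_le_sum_abs _ _
    have hiV : Integrable (fun z => |V (Real.pi / 2) z - V 0 z|) (μ.prod μ) :=
      (integrable_finsetSum _ fun k _ => hi k).mono'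
        ((hV _).sub (hV 0)).abs.aestronglyMeasurable
        (ae_of_all _ fun z => by simpa using hpt z)
    calc ∫ z, |V (Real.pi / 2) z - V 0 z| ∂(μ.prod μ)
        ≤ ∫ z, ∑ k ∈ Finset.range (n + 1), |V ((k : ℝ) * δ + δ) z - V (k * δ) z| ∂(μ.prod μ) :=
          integral_mono hiV (integrable_finsetSum _ fun k _ => hi k) hpt
      _ = ∑ k ∈ Finset.range (n + 1), ∫ z, |V ((k : ℝ) * δ + δ) z - V (k * δ) z| ∂(μ.prod μ) :=
          integral_finsetSum _ fun k _ => hi k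
      _ ≤ ∑ k ∈ Finset.range (n + 1), (δ * s + δ ^ 2 * M) :=
          Finset.sum_le_sum fun k _ => (hstep _ _ hδ0 hδ2).2
      _ = ((n : ℝ) + 1) * δ * s + ((n : ℝ) + 1) * δ * (δ * M) := by
          rw [Finset.sum_const, Finset.card_range, nsmul_eq_mul]; push_cast; ring
      _ = Real.pi / 2 * s + (Real.pi / 2) ^ 2 * M * (1 / ((n : ℝ) + 1)) := by
          rw [hnδ, hδ]; ring
  have lim : Tendsto (fun n : ℕ => Real.pi / 2 * s
      + (Real.pi / 2) ^ 2 * M * (1 / ((n : ℝ) + 1))) atTop (𝓝 (Real.pi / 2 * s)) := by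
    simpa using ((tendsto_one_div_add_atTop_nhds_zero_nat (𝕜 := ℝ)).const_mul
      ((Real.pi / 2) ^ 2 * M)).const_add (Real.pi / 2 * s)
  have hfin := ge_of_tendsto' lim key
  simpa [V] using hfin

/-- Concentration of the free energy of a Gaussian vector with covariances at most `s ^ 2`. -/
theorem integral_abs_logSumExp_sub_integral_le (h : IsCenteredGaussian μ C) {s : ℝ} (hs : 0 < s)
    (hC : ∀ i j, C i j ≤ s ^ 2) (c : ι → ℝ) :
    ∫ x, |logSumExp (c + x) - ∫ y, logSumExp (c + y) ∂μ| ∂μ ≤ Real.pi / 2 * s := by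
  have := h.1
  refine le_trans ?_ (h.integral_abs_logSumExp_prod_le hs hC c)
  have hF := h.integrable_logSumExp c
  have hi : Integrable (fun z : (ι → ℝ) × (ι → ℝ) =>
      |logSumExp (c + z.2) - logSumExp (c + z.1)|) (μ.prod μ) :=
    ((hF.comp_snd μ).sub (hF.comp_fst μ)).abs
  rw [integral_prod _ hi]
  refine integral_mono (hF.sub (integrable_const _)).abs hi.integral_prod_left fun x => ?_
  -- The mean is the average over an independent copy, so the absolute value can be moved inside
  -- that average.
  have e : logSumExp (c + x) - ∫ y, logSumExp (c + y) ∂μ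
      = -∫ y, (logSumExp (c + y) - logSumExp (c + x)) ∂μ := by
    rw [integral_sub hF (integrable_const _)]; simp
  simp only [e, abs_neg]
  exact abs_integral_le_integral_abs

end IsCenteredGaussian

end Concentration

/-! ### Linear combinations of independent Gaussian variables. -/

section GaussianSums

variable {Ω : Type*} [MeasurableSpace Ω] {P : Measure Ω} {J : Type*} [Fintype J]
  {Y : J → Ω → ℝ} {w : J → ℝ≥0}

lemma hasLaw_sum_gaussian [IsProbabilityMeasure P]
    (hY : ∀ j, HasLaw (Y j) (gaussianReal 0 (w j)) P) (hind : iIndepFun Y P) (c : J → ℝ) :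
    HasLaw (fun ω => ∑ j, c j * Y j ω) (gaussianReal 0 (∑ j, (c j ^ 2).toNNReal * w j)) P := by
  have hc := fun j => gaussianReal_const_mul (hY j) (c j)
  have hm : AEMeasurable (fun ω => ∑ j, c j * Y j ω) P :=
    Finset.aemeasurable_fun_sum _ fun j _ => (hc j).aemeasurable
  refine ⟨hm, ?_⟩
  have : IsProbabilityMeasure (P.map fun ω => ∑ j, c j * Y j ω) :=
    Measure.isProbabilityMeasure_map hm
  refine Measure.ext_of_charFun ?_
  have hi : iIndepFun (fun j ω => c j * Y j ω) P :=
    hind.comp (fun j x => c j * x) fun j => by fun_prop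
  rw [hi.charFun_map_fun_sum_eq_prod fun j => (hc j).aemeasurable]
  funext t
  rw [Finset.prod_apply, charFun_gaussianReal]
  simp only [(hc _).map_eq, charFun_gaussianReal]
  rw [← Complex.exp_sum]
  congr 1
  push_cast
  simp only [mul_zero, zero_mul, zero_sub, Real.coe_toNNReal _ (sq_nonneg _),
    Finset.sum_neg_distrib, Finset.sum_mul, Finset.sum_div,
    Complex.ofReal_pow]

lemma coe_sum_sq_mul (c : J → ℝ) :
    ((∑ j, (c j ^ 2).toNNReal * w j : ℝ≥0) : ℝ) = ∑ j, c j ^ 2 * w j := by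
  push_cast
  simp only [Real.coe_toNNReal _ (sq_nonneg _)]

lemma integral_exp_of_hasLaw_gaussian {X : Ω → ℝ} {u : ℝ≥0}
    (hX : HasLaw X (gaussianReal 0 u) P) :
    ∫ ω, Complex.exp ((X ω : ℂ) * Complex.I) ∂P = ((Real.exp (-(u : ℝ) / 2) : ℝ) : ℂ) := by
  have h := charFun_gaussianReal (μ := 0) (v := u) 1
  rw [charFun_apply_real] at h
  have e := hX.integral_comp (f := fun x : ℝ => Complex.exp ((x : ℂ) * Complex.I)) (by fun_prop)
  simp only [Function.comp_def] at e
  rw [e]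
  simp only [Complex.ofReal_one, one_mul] at h
  rw [h]
  push_cast
  congr 1
  ring

lemma lintegral_sq_of_hasLaw_gaussian {X : Ω → ℝ} {u : ℝ≥0}
    (hX : HasLaw X (gaussianReal 0 u) P) : ∫⁻ ω, ENNReal.ofReal (X ω ^ 2) ∂P = u := by
  have e := hX.lintegral_comp (f := fun x : ℝ => ENNReal.ofReal (x ^ 2)) (by fun_prop)
  rw [e, ← ofReal_integral_eq_lintegral_ofReal]
  · have e2 := variance_fun_id_gaussianReal (μ := 0) (v := u)
    rw [variance_of_integral_eq_zero (by fun_prop) integral_id_gaussianReal] at e2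
    rw [e2, ENNReal.ofReal_coe_nnreal]
  · exact (memLp_id_gaussianReal 2).integrable_sq
  · exact ae_of_all _ fun x => sq_nonneg x

end GaussianSums

/-! ### Overlaps and the covariance of the Hamiltonian. -/

section Kernel

/-- The sum of the products of the spins of two configurations. -/
def spinProduct {N : ℕ} (σ τ : Config N) : ℝ := ∑ i, spin σ i * spin τ i

/-- The covariance function of the mixed even-spin interaction, with `v` the variance of the
external field. -/
def mixture (B : ℕ+ → ℝ) (v : ℝ≥0) (x : ℝ) : ℝ :=
  v * x + ∑' p : ℕ+, B p ^ 2 * x ^ (2 * (p : ℕ))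

/-- The covariance of the Hamiltonian, including the random external field. -/
def covKernel (B : ℕ+ → ℝ) (v : ℝ≥0) {N : ℕ} (σ τ : Config N) : ℝ :=
  N * mixture B v (spinProduct σ τ / N)

variable {N : ℕ}

lemma spin_eq_or (σ : Config N) (i : Fin N) : spin σ i = 1 ∨ spin σ i = -1 := by
  rcases Int.units_eq_one_or (σ i) with h | h <;> simp [spin, h]

lemma abs_spin (σ : Config N) (i : Fin N) : |spin σ i| = 1 := by
  rcases spin_eq_or σ i with h | h <;> simp [h]

lemma spin_mul_self (σ : Config N) (i : Fin N) : spin σ i * spin σ i = 1 := by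
  rcases spin_eq_or σ i with h | h <;> simp [h]

lemma spinProduct_self (σ : Config N) : spinProduct σ σ = N := by
  simp [spinProduct, spin_mul_self]

lemma abs_spinProduct_le (σ τ : Config N) : |spinProduct σ τ| ≤ N := by
  refine (Finset.abs_sum_le_sum_abs _ _).trans ?_
  simp [abs_mul, abs_spin]

lemma abs_spinProduct_div_le (σ τ : Config N) : |spinProduct σ τ / N| ≤ 1 := by
  rw [abs_div, Nat.abs_cast]
  exact div_le_one_of_le₀ (abs_spinProduct_le σ τ) (Nat.cast_nonneg N)

lemma summable_sq_of_temperatures {β : ℝ} {B : ℕ+ → ℝ} (hB : (β, B) ∈ temperatures) :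
    Summable fun p : ℕ+ => B p ^ 2 := by
  refine hB.2.of_nonneg_of_le (fun p => sq_nonneg _) fun p => ?_
  exact le_mul_of_one_le_left (sq_nonneg _) (one_le_pow₀ (by norm_num))

lemma summable_mixture {B : ℕ+ → ℝ} (hB : Summable fun p : ℕ+ => B p ^ 2) {x : ℝ}
    (hx : |x| ≤ 1) : Summable fun p : ℕ+ => B p ^ 2 * x ^ (2 * (p : ℕ)) := by
  refine hB.of_nonneg_of_le (fun p => mul_nonneg (sq_nonneg _) ((even_two_mul _).pow_nonneg x))
    fun p => mul_le_of_le_one_right (sq_nonneg _) ?_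
  rw [← (even_two_mul (p : ℕ)).pow_abs]
  exact pow_le_one₀ (abs_nonneg _) hx

/-- After expanding the square, the sum over site tuples factorizes into a power of the overlap. The
case `k = 2p` gives the interaction variance, `k = 1` that of the field. -/
lemma sum_sum_mul_prod_spin_sq (t : Config N → ℝ) (k : ℕ) :
    ∑ i : Fin k → Fin N, (∑ σ, t σ * ∏ l, spin σ (i l)) ^ 2
      = ∑ σ, ∑ τ, t σ * t τ * spinProduct σ τ ^ k := by
  have h : ∀ i : Fin k → Fin N, (∑ σ, t σ * ∏ l, spin σ (i l)) ^ 2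
      = ∑ σ, ∑ τ, t σ * t τ * ∏ l, (spin σ (i l) * spin τ (i l)) := by
    intro i
    rw [sq, Finset.sum_mul_sum]
    refine Finset.sum_congr rfl fun σ _ => Finset.sum_congr rfl fun τ _ => ?_
    rw [Finset.prod_mul_distrib]; ring
  simp only [h]
  rw [Finset.sum_comm]
  refine Finset.sum_congr rfl fun σ _ => ?_
  rw [Finset.sum_comm]
  refine Finset.sum_congr rfl fun τ _ => ?_
  rw [← Finset.mul_sum, spinProduct, Fintype.sum_pow]

lemma rpow_sub_half_sq (hN : 1 ≤ N) (p : ℕ+) :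
    ((N : ℝ) ^ ((p : ℝ) - 1 / 2)) ^ 2 = (N : ℝ) ^ (2 * (p : ℕ)) / N := by
  have hN0 : (0 : ℝ) < N := by exact_mod_cast hN
  rw [← Real.rpow_natCast, ← Real.rpow_mul hN0.le,
    show ((p : ℝ) - 1 / 2) * ((2 : ℕ) : ℝ) = ((2 * (p : ℕ) : ℕ) : ℝ) - 1 by push_cast; ring,
    Real.rpow_sub hN0, Real.rpow_natCast, Real.rpow_one]

end Kernel

/-! ### The law of the truncated Hamiltonian. -/

section ModelLaw

variable {Ω : Type*} [MeasurableSpace Ω] {P : Measure Ω} [IsProbabilityMeasure P]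
  {β : ℝ} {B : ℕ+ → ℝ} {m : ℝ} {v : ℝ≥0} {g : Couplings Ω} {h : ℕ → Ω → ℝ} {N : ℕ}

/-- The embedding of the finitely many disorder variables with orders in `s` and sites below `N`
into all disorder variables. -/
def siteEmbedding (s : Finset ℕ+) (N : ℕ) :
    ((p : s) × (Fin (2 * ((p : ℕ+) : ℕ)) → Fin N)) ⊕ Fin N →
      ((p : ℕ+) × (Fin (2 * (p : ℕ)) → ℕ)) ⊕ ℕ :=
  Sum.map (fun q => ⟨q.1, fun k => (q.2 k : ℕ)⟩) (fun i => (i : ℕ))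

lemma siteEmbedding_injective (s : Finset ℕ+) (N : ℕ) :
    Function.Injective (siteEmbedding s N) := by
  refine Function.Injective.sumMap ?_ Fin.val_injective
  rintro ⟨⟨p, hp⟩, i⟩ ⟨⟨q, hq⟩, j⟩ hpq
  simp only [Sigma.mk.injEq] at hpq
  obtain ⟨rfl, hij⟩ := hpq
  have : i = j := by
    funext k
    exact Fin.val_injective (congrFun (eq_of_heq hij) k)
  rw [this]

/-- The disorder variables, with the external field centered. -/
def centeredDisorder (g : Couplings Ω) (h : ℕ → Ω → ℝ) (m : ℝ) :
    ((p : ℕ+) × (Fin (2 * (p : ℕ)) → ℕ)) ⊕ ℕ → Ω → ℝ :=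
  Sum.elim (fun q => g q.1 q.2) (fun i ω => h i ω - m)

/-- The Gaussian part of the Hamiltonian, truncated to the orders in `s`. -/
def truncatedField (B : ℕ+ → ℝ) (g : Couplings Ω) (h : ℕ → Ω → ℝ) (m : ℝ) (N : ℕ)
    (s : Finset ℕ+) (ω : Ω) (σ : Config N) : ℝ :=
  ∑ p ∈ s, pSpinTerm B g N ω σ p + ∑ i : Fin N, (h i ω - m) * spin σ i

/-- The Gaussian part of the Hamiltonian. -/
def gaussianField (B : ℕ+ → ℝ) (g : Couplings Ω) (h : ℕ → Ω → ℝ) (m : ℝ) (N : ℕ)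
    (ω : Ω) (σ : Config N) : ℝ :=
  skInteraction B g N ω σ + ∑ i : Fin N, (h i ω - m) * spin σ i

omit [IsProbabilityMeasure P] in
lemma IsDisorder.iIndepFun_centeredDisorder (hgh : IsDisorder P g h m v) :
    iIndepFun (centeredDisorder g h m) P := by
  have := hgh.indep.comp (fun j => Sum.elim (fun _ x => x) (fun _ x => x - m) j) (by
    rintro (q | i) <;> simp only [Sum.elim_inl, Sum.elim_inr] <;> fun_prop)
  convert this using 1
  funext j
  rcases j with q | i <;> rfl

omit [IsProbabilityMeasure P] in
lemma IsDisorder.hasLaw_centeredDisorder (hgh : IsDisorder P g h m v)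
    (j : ((p : ℕ+) × (Fin (2 * (p : ℕ)) → ℕ)) ⊕ ℕ) :
    HasLaw (centeredDisorder g h m j)
      (gaussianReal 0 (Sum.elim (fun _ => 1) (fun _ => v) j)) P := by
  rcases j with q | i
  · exact hgh.law_couplings _ _
  · simpa [centeredDisorder] using gaussianReal_sub_const (hgh.law_field i) m

lemma IsDisorder.hasLaw_sum_truncatedField (hgh : IsDisorder P g h m v) (s : Finset ℕ+)
    (hN : 1 ≤ N) (t : Config N → ℝ) :
    ∃ u : ℝ≥0, (u : ℝ) = quadForm (fun σ τ => v * spinProduct σ τ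
        + ∑ p ∈ s, N * (B p ^ 2 * (spinProduct σ τ / N) ^ (2 * (p : ℕ)))) t ∧
      HasLaw (fun ω => ∑ σ, t σ * truncatedField B g h m N s ω σ) (gaussianReal 0 u) P := by
  have hN0 : (0 : ℝ) < N := by exact_mod_cast hN
  let c : ((p : s) × (Fin (2 * ((p : ℕ+) : ℕ)) → Fin N)) ⊕ Fin N → ℝ :=
    Sum.elim (fun q => B q.1 / (N : ℝ) ^ (((q.1 : ℕ+) : ℝ) - 1 / 2) *
      ∑ σ, t σ * ∏ k, spin σ (q.2 k)) (fun i => ∑ σ, t σ * spin σ i)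
  have H := hasLaw_sum_gaussian (fun j => hgh.hasLaw_centeredDisorder (siteEmbedding s N j))
    (hgh.iIndepFun_centeredDisorder.precomp (siteEmbedding_injective s N)) c
  refine ⟨∑ j, (c j ^ 2).toNNReal *
    Sum.elim (fun _ => 1) (fun _ => v) (siteEmbedding s N j), ?_, ?_⟩
  rotate_left
  · refine H.congr (ae_of_all _ fun ω => ?_)
    simp only [Fintype.sum_sum_type, Fintype.sum_sigma, c, siteEmbedding, centeredDisorder,
      truncatedField, Sum.elim_inl, Sum.elim_inr, Sum.map_inl, Sum.map_inr, mul_add,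
      Finset.sum_add_distrib]
    congr 1
    · simp only [Finset.mul_sum, pSpinTerm]
      rw [Finset.sum_comm, Finset.sum_coe_sort s (fun p : ℕ+ => ∑ i : Fin (2 * (p : ℕ)) → Fin N,
        (∑ σ, B p / (N : ℝ) ^ ((p : ℝ) - 1 / 2) * (t σ * ∏ k, spin σ (i k))) *
          g p (fun k => (i k : ℕ)) ω)]
      refine Finset.sum_congr rfl fun p _ => ?_
      simp only [Finset.sum_mul]
      rw [Finset.sum_comm]
      refine Finset.sum_congr rfl fun σ _ => Finset.sum_congr rfl fun i _ => ?_
      ring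
    · simp only [Finset.mul_sum, Finset.sum_mul]
      rw [Finset.sum_comm]
      refine Finset.sum_congr rfl fun σ _ => Finset.sum_congr rfl fun i _ => ?_
      ring
  · rw [coe_sum_sq_mul]
    simp only [Fintype.sum_sum_type, Fintype.sum_sigma, c, siteEmbedding,
      Sum.elim_inl, Sum.elim_inr, Sum.map_inl, Sum.map_inr, NNReal.coe_one, mul_one, mul_pow,
      ← Finset.mul_sum, ← Finset.sum_mul, sum_sum_mul_prod_spin_sq, quadForm, mul_add,
      Finset.sum_add_distrib]
    rw [add_comm]
    congr 1
    -- Field part: one-element tuples of sites are identified with sites.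
    · have e := sum_sum_mul_prod_spin_sq t 1
      simp only [pow_one, Finset.univ_unique, Finset.prod_singleton] at e
      rw [← (Equiv.funUnique (Fin 1) (Fin N)).symm.sum_comp] at e
      simp only [Equiv.funUnique_symm_apply, uniqueElim_const] at e
      rw [e, Finset.sum_mul]
      refine Finset.sum_congr rfl fun σ _ => ?_
      rw [Finset.sum_mul]
      refine Finset.sum_congr rfl fun τ _ => ?_
      ring
    · rw [Finset.sum_coe_sort s (fun p : ℕ+ => (B p / (N : ℝ) ^ ((p : ℝ) - 1 / 2)) ^ 2 *
        ∑ σ, ∑ τ, t σ * t τ * spinProduct σ τ ^ (2 * (p : ℕ)))]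
      simp only [Finset.mul_sum]
      rw [Finset.sum_comm]
      refine Finset.sum_congr rfl fun σ _ => ?_
      rw [Finset.sum_comm]
      refine Finset.sum_congr rfl fun τ _ => Finset.sum_congr rfl fun p _ => ?_
      rw [div_pow, rpow_sub_half_sq hN, div_pow]
      field_simp

end ModelLaw

/-! ### Convergence of the series over `p` and the law of its sum. -/

section FieldLaw

variable {Ω : Type*} [MeasurableSpace Ω] {P : Measure Ω} [IsProbabilityMeasure P]
  {β : ℝ} {B : ℕ+ → ℝ} {m : ℝ} {v : ℝ≥0} {g : Couplings Ω} {h : ℕ → Ω → ℝ} {N : ℕ}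

omit [IsProbabilityMeasure P] in
lemma IsDisorder.aemeasurable_pSpinTerm (hgh : IsDisorder P g h m v) (σ : Config N) (p : ℕ+) :
    AEMeasurable (fun ω => pSpinTerm B g N ω σ p) P := by
  unfold pSpinTerm
  exact (Finset.aemeasurable_fun_sum _ fun i _ =>
    (hgh.law_couplings p _).aemeasurable.mul_const _).const_mul _

lemma IsDisorder.lintegral_pSpinTerm_sq (hgh : IsDisorder P g h m v) (hN : 1 ≤ N)
    (σ : Config N) (p : ℕ+) :
    ∫⁻ ω, ENNReal.ofReal (pSpinTerm B g N ω σ p ^ 2) ∂P = ENNReal.ofReal (N * B p ^ 2) := by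
  have hN0 : (0 : ℝ) < N := by exact_mod_cast hN
  let e : (Fin (2 * (p : ℕ)) → Fin N) → ((p : ℕ+) × (Fin (2 * (p : ℕ)) → ℕ)) ⊕ ℕ :=
    fun i => Sum.inl ⟨p, fun k => (i k : ℕ)⟩
  have he : Function.Injective e := by
    intro i j hij
    simp only [e, Sum.inl.injEq, Sigma.mk.injEq, heq_eq_eq, true_and] at hij
    funext k
    exact Fin.val_injective (congrFun hij k)
  have H := hasLaw_sum_gaussian (fun j => hgh.hasLaw_centeredDisorder (e j))
    (hgh.iIndepFun_centeredDisorder.precomp he)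
    (fun i => B p / (N : ℝ) ^ ((p : ℝ) - 1 / 2) * ∏ k, spin σ (i k))
  have H' : HasLaw (fun ω => pSpinTerm B g N ω σ p) _ P := H.congr (ae_of_all _ fun ω => by
    simp only [pSpinTerm, Finset.mul_sum, e, centeredDisorder, Sum.elim_inl]
    exact Finset.sum_congr rfl fun i _ => by ring)
  rw [lintegral_sq_of_hasLaw_gaussian H', ← ENNReal.ofReal_coe_nnreal, coe_sum_sq_mul]
  congr 1
  have hprod : ∀ i : Fin (2 * (p : ℕ)) → Fin N, (∏ k, spin σ (i k)) ^ 2 = 1 := by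
    intro i
    rw [← Finset.prod_pow]
    exact Finset.prod_eq_one fun k _ => by rw [sq, spin_mul_self]
  simp only [e, Sum.elim_inl, NNReal.coe_one, mul_one, mul_pow, hprod, Finset.sum_const,
    Finset.card_univ, Fintype.card_fun, Fintype.card_fin, nsmul_eq_mul, div_pow,
    rpow_sub_half_sq hN]
  push_cast
  field_simp

/-- The second moment of the `p`-th term is `N β_p²`, so the terms squared with weights `2 ^ p` have
a finite expected sum. Almost surely `|u| ≤ 2 ^ p u² + 2 ^ (-p)` is then summable; this is where the
weight `2 ^ p` is needed. -/
lemma IsDisorder.ae_summable_pSpinTerm (hB : (β, B) ∈ temperatures)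
    (hgh : IsDisorder P g h m v) (hN : 1 ≤ N) :
    ∀ᵐ ω ∂P, ∀ σ : Config N, Summable (pSpinTerm B g N ω σ) := by
  rw [ae_all_iff]
  intro σ
  have hmeas : ∀ p : ℕ+, AEMeasurable
      (fun ω => ENNReal.ofReal ((2 : ℝ) ^ (p : ℕ) * pSpinTerm B g N ω σ p ^ 2)) P := fun p =>
    (((hgh.aemeasurable_pSpinTerm σ p).pow_const 2).const_mul _).ennreal_ofReal
  have hint : ∀ p : ℕ+, ∫⁻ ω, ENNReal.ofReal ((2 : ℝ) ^ (p : ℕ) * pSpinTerm B g N ω σ p ^ 2) ∂P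
      = ENNReal.ofReal (N * ((2 : ℝ) ^ (p : ℕ) * B p ^ 2)) := by
    intro p
    have h2 : (0 : ℝ) ≤ 2 ^ (p : ℕ) := by positivity
    simp only [ENNReal.ofReal_mul h2]
    rw [lintegral_const_mul' _ _ ENNReal.ofReal_ne_top, hgh.lintegral_pSpinTerm_sq hN,
      ← ENNReal.ofReal_mul h2]
    congr 1
    ring
  have hfin : ∫⁻ ω, ∑' p : ℕ+, ENNReal.ofReal ((2 : ℝ) ^ (p : ℕ) * pSpinTerm B g N ω σ p ^ 2) ∂P
      ≠ ⊤ := by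
    rw [lintegral_tsum hmeas]
    simp only [hint]
    exact (hB.2.mul_left (N : ℝ)).tsum_ofReal_ne_top
  filter_upwards [ae_lt_top' (AEMeasurable.tsum hmeas) hfin] with ω hω
  have hs := ENNReal.summable_toReal hω.ne
  have hs' : Summable fun p : ℕ+ => (2 : ℝ) ^ (p : ℕ) * pSpinTerm B g N ω σ p ^ 2 := by
    refine hs.congr fun p => ?_
    rw [ENNReal.toReal_ofReal (by positivity)]
  have hgeo : Summable fun p : ℕ+ => (1 / 2 : ℝ) ^ (p : ℕ) :=
    (summable_geometric_of_lt_one (by norm_num) (by norm_num)).comp_injective PNat.coe_injective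
  refine Summable.of_norm_bounded (hs'.add hgeo) fun p => ?_
  set u := pSpinTerm B g N ω σ p
  have h2 : (0 : ℝ) < 2 ^ (p : ℕ) := by positivity
  have e : (1 / 2 : ℝ) ^ (p : ℕ) = ((2 : ℝ) ^ (p : ℕ))⁻¹ := by rw [one_div, inv_pow]
  rw [Real.norm_eq_abs, e]
  set a := (2 : ℝ) ^ (p : ℕ)
  have ha : a * a⁻¹ = 1 := mul_inv_cancel₀ h2.ne'
  have hai : 0 < a⁻¹ := inv_pos.2 h2
  have e2 : a * u ^ 2 + a⁻¹ - |u| = a * (|u| - a⁻¹ / 2) ^ 2 + 3 / 4 * a⁻¹ := by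
    rw [← sq_abs u]; field_simp; ring
  have : 0 ≤ a * (|u| - a⁻¹ / 2) ^ 2 + 3 / 4 * a⁻¹ := by positivity
  linarith

lemma IsDisorder.ae_tendsto_truncatedField (hB : (β, B) ∈ temperatures)
    (hgh : IsDisorder P g h m v) (hN : 1 ≤ N) :
    ∀ᵐ ω ∂P, ∀ σ : Config N, Tendsto (fun s => truncatedField B g h m N s ω σ) atTop
      (𝓝 (gaussianField B g h m N ω σ)) := by
  filter_upwards [hgh.ae_summable_pSpinTerm hB hN] with ω hω σ
  exact (hω σ).hasSum.add_const _

omit [IsProbabilityMeasure P] in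
lemma IsDisorder.aemeasurable_truncatedField (hgh : IsDisorder P g h m v) (s : Finset ℕ+)
    (σ : Config N) : AEMeasurable (fun ω => truncatedField B g h m N s ω σ) P := by
  unfold truncatedField
  exact (Finset.aemeasurable_fun_sum _ fun p _ => hgh.aemeasurable_pSpinTerm σ p).add
    (Finset.aemeasurable_fun_sum _ fun i _ =>
      ((hgh.law_field _).aemeasurable.sub_const m).mul_const _)

lemma IsDisorder.aemeasurable_gaussianField (hB : (β, B) ∈ temperatures)
    (hgh : IsDisorder P g h m v) (hN : 1 ≤ N) :
    AEMeasurable (fun ω => gaussianField B g h m N ω) P := by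
  rw [aemeasurable_pi_iff]
  intro σ
  refine aemeasurable_of_tendsto_metrizable_ae atTop
    (fun s => hgh.aemeasurable_truncatedField (B := B) s σ) ?_
  filter_upwards [hgh.ae_tendsto_truncatedField hB hN] with ω hω using hω σ

/-- The Gaussian part of the Hamiltonian is a centered Gaussian vector. -/
theorem IsDisorder.isCenteredGaussian (hB : (β, B) ∈ temperatures)
    (hgh : IsDisorder P g h m v) (hN : 1 ≤ N) :
    IsCenteredGaussian (P.map fun ω => gaussianField B g h m N ω) (covKernel (N := N) B v) := by
  have hm := hgh.aemeasurable_gaussianField hB hN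
  have hN0 : (N : ℝ) ≠ 0 := by positivity
  refine ⟨Measure.isProbabilityMeasure_map hm, fun t => ?_⟩
  have hcont : Continuous fun x : Config N → ℝ =>
      Complex.exp (((∑ σ, t σ * x σ : ℝ) : ℂ) * Complex.I) :=
    Complex.continuous_exp.comp ((Complex.continuous_ofReal.comp (by fun_prop)).mul
      continuous_const)
  rw [integral_map hm hcont.aestronglyMeasurable]
  -- The truncated characteristic functions have two limits that must agree: one by dominated
  -- convergence, as their integrands have modulus 1, one by the explicit variances.
  have hlim1 : Tendsto (fun s => ∫ ω, Complex.exp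
        (((∑ σ, t σ * truncatedField B g h m N s ω σ : ℝ) : ℂ) * Complex.I) ∂P) atTop
      (𝓝 (∫ ω, Complex.exp
        (((∑ σ, t σ * gaussianField B g h m N ω σ : ℝ) : ℂ) * Complex.I) ∂P)) := by
    refine tendsto_integral_filter_of_dominated_convergence (fun _ => 1) ?_ ?_
      (integrable_const _) ?_
    · refine Eventually.of_forall fun s => ?_
      have hs : AEMeasurable (fun ω => ∑ σ, t σ * truncatedField B g h m N s ω σ) P :=
        Finset.aemeasurable_fun_sum _ fun σ _ =>
          (hgh.aemeasurable_truncatedField s σ).const_mul _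
      exact (Complex.continuous_exp.measurable.comp_aemeasurable
        ((Complex.measurable_ofReal.comp_aemeasurable hs).mul_const _)).aestronglyMeasurable
    · refine Eventually.of_forall fun s => ae_of_all _ fun ω => ?_
      rw [Complex.norm_exp_ofReal_mul_I]
    · filter_upwards [hgh.ae_tendsto_truncatedField hB hN] with ω hω
      have h1 : Tendsto (fun s => ∑ σ, t σ * truncatedField B g h m N s ω σ) atTop
          (𝓝 (∑ σ, t σ * gaussianField B g h m N ω σ)) :=
        tendsto_finsetSum _ fun σ _ => (hω σ).const_mul _
      have hc : Continuous fun x : ℝ => Complex.exp ((x : ℂ) * Complex.I) := by fun_prop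
      exact (hc.tendsto _).comp h1
  have hlim2 : Tendsto (fun s => ∫ ω, Complex.exp
        (((∑ σ, t σ * truncatedField B g h m N s ω σ : ℝ) : ℂ) * Complex.I) ∂P) atTop
      (𝓝 ((Real.exp (-quadForm (covKernel (N := N) B v) t / 2) : ℝ) : ℂ)) := by
    have e : ∀ s, ∫ ω, Complex.exp
        (((∑ σ, t σ * truncatedField B g h m N s ω σ : ℝ) : ℂ) * Complex.I) ∂P
        = ((Real.exp (-quadForm (fun σ τ => v * spinProduct σ τ
        + ∑ p ∈ s, N * (B p ^ 2 * (spinProduct σ τ / N) ^ (2 * (p : ℕ)))) t / 2) : ℝ) : ℂ) := by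
      intro s
      obtain ⟨u, hu, hlaw⟩ := hgh.hasLaw_sum_truncatedField (B := B) s hN t
      rw [integral_exp_of_hasLaw_gaussian hlaw, hu]
    simp only [e]
    have hq : Tendsto (fun s : Finset ℕ+ => quadForm (fun σ τ : Config N => v * spinProduct σ τ
        + ∑ p ∈ s, N * (B p ^ 2 * (spinProduct σ τ / N) ^ (2 * (p : ℕ)))) t) atTop
        (𝓝 (quadForm (covKernel (N := N) B v) t)) := by
      refine tendsto_finsetSum _ fun σ _ => tendsto_finsetSum _ fun τ _ =>
        Tendsto.const_mul _ ?_
      have hs := (summable_mixture (summable_sq_of_temperatures hB)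
        (abs_spinProduct_div_le σ τ)).hasSum.mul_left (N : ℝ)
      have := Tendsto.const_add (v * spinProduct σ τ) hs
      have e : (N : ℝ) * (v * (spinProduct σ τ / N)) = v * spinProduct σ τ := by field_simp
      rw [covKernel, mixture, mul_add, e]
      exact this
    exact ((Complex.continuous_ofReal.comp Real.continuous_exp).tendsto _).comp
      ((hq.neg).div_const 2)
  exact tendsto_nhds_unique hlim1 hlim2

end FieldLaw

/-! ### The free energy as a Gaussian integral of log-sum-exp. -/

section FreeEnergy

variable {Ω : Type*} [MeasurableSpace Ω] {P : Measure Ω} [IsProbabilityMeasure P]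
  {β : ℝ} {B : ℕ+ → ℝ} {m : ℝ} {v : ℝ≥0} {g : Couplings Ω} {h : ℕ → Ω → ℝ} {N : ℕ}

/-- The deterministic part of the Hamiltonian, with external field `c`. -/
def meanField (b c : ℝ) (N : ℕ) (σ : Config N) : ℝ :=
  b * N / 2 * magnetization σ ^ 2 + c * ∑ i, spin σ i

omit [MeasurableSpace Ω] in
-- Moving the mean `m` of the fields into the deterministic part leaves a random part independent of
-- `b` and `c`, so free energies for all `b` and `c` are integrals against one measure.
lemma log_partitionFunction_eq (b c m : ℝ) (ω : Ω) :
    Real.log (partitionFunction b B g (shiftField c h) N ω)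
      = logSumExp (meanField b (c + m) N + gaussianField B g h m N ω) := by
  have e : ∀ σ : Config N, hamiltonian b B g (shiftField c h) N ω σ
      = (meanField b (c + m) N + gaussianField B g h m N ω) σ := by
    intro σ
    have : ∑ i : Fin N, shiftField c h i ω * spin σ i
        = (c + m) * ∑ i, spin σ i + ∑ i : Fin N, (h i ω - m) * spin σ i := by
      rw [Finset.mul_sum, ← Finset.sum_add_distrib]
      exact Finset.sum_congr rfl fun i _ => by rw [shiftField]; ring
    rw [hamiltonian, this, Pi.add_apply, meanField, gaussianField]
    ring
  simp only [partitionFunction, logSumExp, e]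

variable (P B g h m N) in
/-- The law of the Gaussian part of the Hamiltonian. -/
def fieldLaw : Measure (Config N → ℝ) := P.map fun ω => gaussianField B g h m N ω

lemma IsDisorder.integrable_log_partitionFunction (hB : (β, B) ∈ temperatures)
    (hgh : IsDisorder P g h m v) (hN : 1 ≤ N) (b c : ℝ) :
    Integrable (fun ω => Real.log (partitionFunction b B g (shiftField c h) N ω)) P := by
  simp only [log_partitionFunction_eq b c m]
  have hG := hgh.isCenteredGaussian hB hN
  exact (hG.integrable_logSumExp (meanField b (c + m) N)).comp_aemeasurable
    (hgh.aemeasurable_gaussianField hB hN)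

lemma IsDisorder.freeEnergy_eq (hB : (β, B) ∈ temperatures)
    (hgh : IsDisorder P g h m v) (hN : 1 ≤ N) (b c : ℝ) :
    freeEnergy P b B g (shiftField c h) N
      = (N : ℝ)⁻¹ * ∫ x, logSumExp (meanField b (c + m) N + x) ∂(fieldLaw P B m g h N) := by
  rw [freeEnergy]
  simp only [log_partitionFunction_eq b c m]
  rw [fieldLaw, integral_map (hgh.aemeasurable_gaussianField hB hN)
    (continuous_logSumExp_add _).aestronglyMeasurable]

end FreeEnergy

/-! ### The annealed bound and the splitting into independent parts. -/

section Tools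

variable {ι κ : Type*} [Fintype ι] [Fintype κ] {μ : Measure (ι → ℝ)} {C : ι → ι → ℝ}

/-- Precomposition with `φ`, as a continuous linear map. -/
def precompCLM (φ : κ → ι) : (ι → ℝ) →L[ℝ] (κ → ℝ) :=
  ContinuousLinearMap.pi fun k => ContinuousLinearMap.proj (φ k)

omit [Fintype ι] [Fintype κ] in
lemma precompCLM_apply (φ : κ → ι) (x : ι → ℝ) (k : κ) : precompCLM φ x k = x (φ k) := rfl

lemma IsCenteredGaussian.map_precomp (h : IsCenteredGaussian μ C) (φ : κ → ι) :
    IsCenteredGaussian (μ.map (precompCLM φ)) (fun k l => C (φ k) (φ l)) := by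
  refine h.map_linear (precompCLM φ) fun t s hts => ?_
  have key : ∀ x : ι → ℝ, ∑ i, s i * x i = ∑ k, t k * x (φ k) := by
    intro x
    have := congrArg (fun L : StrongDual ℝ (ι → ℝ) => L x) hts
    simpa [dotForm_apply, precompCLM_apply] using this.symm
  have e1 : quadForm C s = ∑ i, s i * ∑ j, s j * C i j := by
    simp only [quadForm, Finset.mul_sum, mul_assoc]
  rw [e1, key]
  simp only [key, quadForm, Finset.mul_sum, mul_assoc]

lemma IsCenteredGaussian.integral_exp_eval (h : IsCenteredGaussian μ C) (i : ι) :
    Integrable (fun x => Real.exp (x i)) μ ∧ ∫ x, Real.exp (x i) ∂μ = Real.exp (C i i / 2) := by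
  classical
  have hd : ∀ x : ι → ℝ, dotForm (Pi.single i 1) x = x i := fun x => by
    simp [dotForm_apply, Pi.single_apply]
  have hmap := h.map_dotForm (Pi.single i 1)
  have hm := mgf_gaussianReal hmap 1
  have hint := integrable_exp_mul_gaussianReal (μ := 0) (v := (quadForm C (Pi.single i 1)).toNNReal)
    1
  rw [← hmap, integrable_map_measure (by fun_prop) (by fun_prop)] at hint
  simp only [Function.comp_def, hd, one_mul] at hint
  refine ⟨hint, ?_⟩
  simp only [mgf, hd, one_mul, quadForm_single] at hm
  have h0 : 0 ≤ C i i := by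
    have := h.quadForm_nonneg (Pi.single i 1)
    rwa [quadForm_single] at this
  rw [hm, Real.coe_toNNReal _ h0]
  congr 1
  ring

/-- The annealed upper bound for the free energy. -/
lemma IsCenteredGaussian.integral_logSumExp_le [Nonempty ι] (h : IsCenteredGaussian μ C) {L : ℝ}
    (hC : ∀ i, C i i ≤ L) (a : ι → ℝ) :
    ∫ x, logSumExp (a + x) ∂μ ≤ logSumExp a + L / 2 := by
  have := h.1
  set A : ℝ := (∑ i, Real.exp (a i)) * Real.exp (L / 2) with hA
  have hA0 : 0 < A := mul_pos (sum_exp_pos a) (Real.exp_pos _)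
  have hlogA : Real.log A = logSumExp a + L / 2 := by
    rw [hA, Real.log_mul (sum_exp_pos a).ne' (Real.exp_pos _).ne', Real.log_exp, logSumExp]
  have hi : Integrable (fun x : ι → ℝ => ∑ i, Real.exp (a i) * Real.exp (x i)) μ :=
    integrable_finsetSum _ fun i _ => (h.integral_exp_eval i).1.const_mul _
  have hle : ∫ x, ∑ i, Real.exp (a i) * Real.exp (x i) ∂μ ≤ A := by
    rw [integral_finsetSum _ fun i _ => (h.integral_exp_eval i).1.const_mul _, hA, Finset.sum_mul]
    refine Finset.sum_le_sum fun i _ => ?_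
    rw [integral_const_mul, (h.integral_exp_eval i).2]
    gcongr
    exact hC i
  -- The tangent line of `log` at the bound `A` on the mean partition function plays the role of
  -- Jensen's inequality.
  calc ∫ x, logSumExp (a + x) ∂μ
      ≤ ∫ x, (A⁻¹ * (∑ i, Real.exp (a i) * Real.exp (x i)) + (Real.log A - 1)) ∂μ := by
        refine integral_mono (h.integrable_logSumExp a)
          ((hi.const_mul _).add (integrable_const _)) fun x => ?_
        have hz := sum_exp_pos (a + x)
        have e : ∑ i, Real.exp (a i) * Real.exp (x i) = ∑ i, Real.exp ((a + x) i) := by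
          simp only [Pi.add_apply, Real.exp_add]
        simp only [e, logSumExp]
        have := Real.log_le_sub_one_of_pos (mul_pos (inv_pos.2 hA0) hz)
        rw [Real.log_mul (inv_pos.2 hA0).ne' hz.ne', Real.log_inv] at this
        linarith
    _ = A⁻¹ * ∫ x, ∑ i, Real.exp (a i) * Real.exp (x i) ∂μ + (Real.log A - 1) := by
        rw [integral_add (hi.const_mul _) (integrable_const _), integral_const_mul]
        simp
    _ ≤ A⁻¹ * A + (Real.log A - 1) := by gcongr
    _ = logSumExp a + L / 2 := by rw [inv_mul_cancel₀ hA0.ne', hlogA]; ring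

lemma logSumExp_precomp_add {ι₁ ι₂ : Type*} [Fintype ι₁] [Fintype ι₂] [Nonempty ι₁] [Nonempty ι₂]
    (e : ι ≃ ι₁ × ι₂) (x : ι₁ → ℝ) (y : ι₂ → ℝ) :
    logSumExp (fun i => x (e i).1 + y (e i).2) = logSumExp x + logSumExp y := by
  rw [logSumExp, logSumExp, logSumExp, ← Real.log_mul (sum_exp_pos x).ne' (sum_exp_pos y).ne',
    Finset.sum_mul_sum, ← Fintype.sum_prod_type', ← e.sum_comp]
  simp only [Real.exp_add]

/-- The free energy of a system is at least the sum of the free energies of two independent parts,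
if the covariance is dominated by the sum of the covariances of the parts. -/
theorem IsCenteredGaussian.add_integral_logSumExp_le {ι₁ ι₂ : Type*} [Fintype ι₁] [Fintype ι₂]
    [Nonempty ι] [Nonempty ι₁] [Nonempty ι₂] (e : ι ≃ ι₁ × ι₂) {μ₁ : Measure (ι₁ → ℝ)}
    {μ₂ : Measure (ι₂ → ℝ)} {C₁ : ι₁ → ι₁ → ℝ} {C₂ : ι₂ → ι₂ → ℝ}
    (h : IsCenteredGaussian μ C) (h₁ : IsCenteredGaussian μ₁ C₁) (h₂ : IsCenteredGaussian μ₂ C₂)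
    (hdiag : ∀ i, C i i = C₁ (e i).1 (e i).1 + C₂ (e i).2 (e i).2)
    (hle : ∀ i j, C i j ≤ C₁ (e i).1 (e j).1 + C₂ (e i).2 (e j).2)
    (a₁ : ι₁ → ℝ) (a₂ : ι₂ → ℝ) :
    ∫ x, logSumExp (a₁ + x) ∂μ₁ + ∫ x, logSumExp (a₂ + x) ∂μ₂
      ≤ ∫ x, logSumExp ((fun i => a₁ (e i).1 + a₂ (e i).2) + x) ∂μ := by
  have p₁ := h₁.1
  have p₂ := h₂.1
  have g₁ := h₁.map_precomp fun i => (e i).1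
  have g₂ := h₂.map_precomp fun i => (e i).2
  have q₁ := g₁.1
  have q₂ := g₂.1
  refine le_trans (le_of_eq ?_) (h.integral_logSumExp_anti (g₁.conv g₂) hdiag hle _)
  set a : ι → ℝ := fun i => a₁ (e i).1 + a₂ (e i).2
  rw [integral_conv ((g₁.conv g₂).integrable_logSumExp a)]
  have inner : ∀ x, ∫ y, logSumExp (a + (x + y)) ∂(μ₂.map (precompCLM fun i => (e i).2))
      = ∫ y, logSumExp (a + (x + precompCLM (fun i => (e i).2) y)) ∂μ₂ := by
    intro x
    simp only [← add_assoc]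
    exact integral_map (by fun_prop) (continuous_logSumExp_add _).aestronglyMeasurable
  have hmeas := (integrable_integral_add_of_conv ((g₁.conv g₂).integrable_logSumExp a)).1
  rw [integral_map (by fun_prop) hmeas]
  simp only [inner]
  have split : ∀ x y, logSumExp (a + (precompCLM (fun i => (e i).1) x
      + precompCLM (fun i => (e i).2) y)) = logSumExp (a₁ + x) + logSumExp (a₂ + y) := by
    intro x y
    rw [← logSumExp_precomp_add e]
    congr 1
    funext i
    simp only [a, Pi.add_apply, precompCLM_apply]
    ring
  simp only [split]
  have i₁ := h₁.integrable_logSumExp a₁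
  have i₂ := h₂.integrable_logSumExp a₂
  have e2 : ∀ x, ∫ y, (logSumExp (a₁ + x) + logSumExp (a₂ + y)) ∂μ₂
      = logSumExp (a₁ + x) + ∫ y, logSumExp (a₂ + y) ∂μ₂ := by
    intro x
    rw [integral_add (integrable_const _) i₂]
    simp
  simp only [e2]
  rw [integral_add i₁ (integrable_const _)]
  simp

end Tools

/-! ### Convexity of the mixture function. -/

section Mixture

variable {B : ℕ+ → ℝ} {v : ℝ≥0} {N : ℕ}

/-- Even powers are convex on the whole line, so overlaps of either sign are allowed. -/
lemma mixture_convex (hB : Summable fun p : ℕ+ => B p ^ 2) {x y a b : ℝ} (hx : |x| ≤ 1)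
    (hy : |y| ≤ 1) (ha : 0 ≤ a) (hb : 0 ≤ b) (hab : a + b = 1) :
    mixture B v (a * x + b * y) ≤ a * mixture B v x + b * mixture B v y := by
  have hxy : |a * x + b * y| ≤ 1 := by
    rw [abs_le] at hx hy ⊢
    constructor <;> nlinarith
  have sx := (summable_mixture hB hx).mul_left a
  have sy := (summable_mixture hB hy).mul_left b
  have key : ∑' p : ℕ+, B p ^ 2 * (a * x + b * y) ^ (2 * (p : ℕ))
      ≤ a * ∑' p : ℕ+, B p ^ 2 * x ^ (2 * (p : ℕ))
        + b * ∑' p : ℕ+, B p ^ 2 * y ^ (2 * (p : ℕ)) := by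
    rw [← tsum_mul_left, ← tsum_mul_left, ← sx.tsum_add sy]
    refine (summable_mixture hB hxy).tsum_le_tsum (fun p => ?_) (sx.add sy)
    have hc := (even_two_mul (p : ℕ)).convexOn_pow.2 (mem_univ x) (mem_univ y) ha hb hab
    simp only [smul_eq_mul] at hc
    calc _ ≤ B p ^ 2 * (a * x ^ (2 * (p : ℕ)) + b * y ^ (2 * (p : ℕ))) := by gcongr
      _ = _ := by ring
  simp only [mixture]
  linarith

lemma mixture_le_mixture_one (hB : Summable fun p : ℕ+ => B p ^ 2) {x : ℝ} (hx : |x| ≤ 1) :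
    mixture B v x ≤ mixture B v 1 := by
  have hx1 : x ≤ 1 := (le_abs_self x).trans hx
  have h1 : ∑' p : ℕ+, B p ^ 2 * x ^ (2 * (p : ℕ)) ≤ ∑' p : ℕ+, B p ^ 2 * 1 ^ (2 * (p : ℕ)) := by
    refine (summable_mixture hB hx).tsum_le_tsum (fun p => ?_)
      (summable_mixture hB (by simp))
    rw [← (even_two_mul (p : ℕ)).pow_abs, one_pow]
    exact mul_le_mul_of_nonneg_left (pow_le_one₀ (abs_nonneg _) hx) (sq_nonneg _)
  have h2 : (v : ℝ) * x ≤ v * 1 := mul_le_mul_of_nonneg_left hx1 v.2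
  rw [mixture, mixture]
  exact add_le_add h2 h1

lemma mixture_one_nonneg : 0 ≤ mixture B v 1 := by
  rw [mixture]
  exact add_nonneg (mul_nonneg v.2 zero_le_one)
    (tsum_nonneg fun p => mul_nonneg (sq_nonneg _) (by simp))

lemma covKernel_le (hB : Summable fun p : ℕ+ => B p ^ 2) (σ τ : Config N) :
    covKernel B v σ τ ≤ N * mixture B v 1 :=
  mul_le_mul_of_nonneg_left (mixture_le_mixture_one hB (abs_spinProduct_div_le σ τ))
    (Nat.cast_nonneg N)

lemma covKernel_self (hN : 1 ≤ N) (σ : Config N) : covKernel B v σ σ = N * mixture B v 1 := by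
  have : (N : ℝ) ≠ 0 := by positivity
  rw [covKernel, spinProduct_self, div_self this]

lemma spinProduct_append {N₁ N₂ : ℕ} (σ τ : Config (N₁ + N₂)) :
    spinProduct σ τ
      = spinProduct ((Fin.appendEquiv N₁ N₂).symm σ).1 ((Fin.appendEquiv N₁ N₂).symm τ).1
      + spinProduct ((Fin.appendEquiv N₁ N₂).symm σ).2 ((Fin.appendEquiv N₁ N₂).symm τ).2 := by
  rw [spinProduct, Fin.sum_univ_add]
  rfl

/-- The overlap of the whole system is the convex combination of the block overlaps with weights `N₁
/ (N₁ + N₂)` and `N₂ / (N₁ + N₂)`. -/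
lemma covKernel_append_le (hB : Summable fun p : ℕ+ => B p ^ 2) {N₁ N₂ : ℕ} (h₁ : 1 ≤ N₁)
    (h₂ : 1 ≤ N₂) (σ τ : Config (N₁ + N₂)) :
    covKernel B v σ τ
      ≤ covKernel B v ((Fin.appendEquiv N₁ N₂).symm σ).1 ((Fin.appendEquiv N₁ N₂).symm τ).1
      + covKernel B v ((Fin.appendEquiv N₁ N₂).symm σ).2 ((Fin.appendEquiv N₁ N₂).symm τ).2 := by
  have p₁ : (0 : ℝ) < N₁ := by exact_mod_cast h₁
  have p₂ : (0 : ℝ) < N₂ := by exact_mod_cast h₂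
  have p : (0 : ℝ) < (N₁ : ℝ) + N₂ := by positivity
  simp only [covKernel]
  rw [spinProduct_append]
  set S₁ := spinProduct ((Fin.appendEquiv N₁ N₂).symm σ).1 ((Fin.appendEquiv N₁ N₂).symm τ).1
  set S₂ := spinProduct ((Fin.appendEquiv N₁ N₂).symm σ).2 ((Fin.appendEquiv N₁ N₂).symm τ).2
  have hc := mixture_convex (v := v) hB (x := S₁ / N₁) (y := S₂ / N₂)
    (a := N₁ / (N₁ + N₂)) (b := N₂ / (N₁ + N₂)) (abs_spinProduct_div_le _ _)
    (abs_spinProduct_div_le _ _) (by positivity) (by positivity) (by field_simp)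
  have e : (N₁ : ℝ) / (N₁ + N₂) * (S₁ / N₁) + N₂ / (N₁ + N₂) * (S₂ / N₂)
      = (S₁ + S₂) / (N₁ + N₂) := by field_simp
  rw [e] at hc
  push_cast
  calc ((N₁ : ℝ) + N₂) * mixture B v ((S₁ + S₂) / (N₁ + N₂))
      ≤ (N₁ + N₂) * (N₁ / (N₁ + N₂) * mixture B v (S₁ / N₁)
        + N₂ / (N₁ + N₂) * mixture B v (S₂ / N₂)) := by gcongr
    _ = _ := by field_simp

end Mixture

/-! ### Superadditivity and the spin-glass limit. -/

section Limit

variable {Ω : Type*} [MeasurableSpace Ω] {P : Measure Ω} [IsProbabilityMeasure P]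
  {β : ℝ} {B : ℕ+ → ℝ} {m : ℝ} {v : ℝ≥0} {g : Couplings Ω} {h : ℕ → Ω → ℝ}

lemma abs_sum_spin_le {N : ℕ} (σ : Config N) : |∑ i, spin σ i| ≤ N := by
  refine (Finset.abs_sum_le_sum_abs _ _).trans ?_
  simp [abs_spin]

lemma logSumExp_meanField_zero_le (c : ℝ) (N : ℕ) :
    logSumExp (meanField 0 c N) ≤ N * (Real.log 2 + |c|) := by
  have h1 : ∀ σ : Config N, meanField 0 c N σ ≤ (fun _ => N * |c| + 0 : Config N → ℝ) σ := by
    intro σ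
    have := abs_sum_spin_le σ
    have h2 : c * ∑ i, spin σ i ≤ |c| * N := by
      refine (le_abs_self _).trans ?_
      rw [abs_mul]
      gcongr
    simp only [meanField, zero_mul, zero_div, zero_add, add_zero]
    linarith
  refine (logSumExp_mono h1).trans (le_of_eq ?_)
  rw [logSumExp_const_add]
  simp only [logSumExp, Real.exp_zero, Finset.sum_const, Finset.card_univ, Fintype.card_fun,
    Fintype.card_fin, Fintype.card_units_int, nsmul_eq_mul, mul_one]
  push_cast
  rw [Real.log_pow]
  ring

lemma IsDisorder.add_integral_le (hB : (β, B) ∈ temperatures) (hgh : IsDisorder P g h m v)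
    {N₁ N₂ : ℕ} (h₁ : 1 ≤ N₁) (h₂ : 1 ≤ N₂) (c : ℝ) :
    ∫ x, logSumExp (meanField 0 c N₁ + x) ∂(fieldLaw P B m g h N₁)
      + ∫ x, logSumExp (meanField 0 c N₂ + x) ∂(fieldLaw P B m g h N₂)
      ≤ ∫ x, logSumExp (meanField 0 c (N₁ + N₂) + x) ∂(fieldLaw P B m g h (N₁ + N₂)) := by
  have hs := summable_sq_of_temperatures hB
  have key := IsCenteredGaussian.add_integral_logSumExp_le (Fin.appendEquiv N₁ N₂).symm
    (hgh.isCenteredGaussian hB (by omega : 1 ≤ N₁ + N₂)) (hgh.isCenteredGaussian hB h₁)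
    (hgh.isCenteredGaussian hB h₂)
    (fun σ => by
      rw [covKernel_self (by omega), covKernel_self h₁, covKernel_self h₂]; push_cast; ring)
    (covKernel_append_le hs h₁ h₂) (meanField 0 c N₁) (meanField 0 c N₂)
  refine key.trans (le_of_eq ?_)
  congr 1
  funext x
  congr 2
  funext σ
  simp only [meanField, zero_mul, zero_div, zero_add]
  rw [Fin.sum_univ_add, mul_add]
  rfl

/-- The free energy of the mixed even-spin model with a shifted external field converges. -/
theorem IsDisorder.exists_tendsto_freeEnergySK (hB : (β, B) ∈ temperatures)
    (hgh : IsDisorder P g h m v) (c : ℝ) :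
    ∃ F, Tendsto (freeEnergySK P B g (shiftField c h)) atTop (𝓝 F) := by
  have hs := summable_sq_of_temperatures hB
  -- The sign turns superadditivity into the subadditivity of Fekete's lemma, and the factor `N`
  -- makes `u 0 = 0`. The annealed bound then bounds `u N / N` from below.
  set u : ℕ → ℝ := fun N => -(N * freeEnergySK P B g (shiftField c h) N) with hu
  have hu0 : u 0 = 0 := by simp [hu]
  have huN : ∀ N, 1 ≤ N →
      u N = -∫ x, logSumExp (meanField 0 (c + m) N + x) ∂(fieldLaw P B m g h N) := by
    intro N hN
    have : (N : ℝ) ≠ 0 := by positivity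
    rw [hu]
    simp only [freeEnergySK]
    rw [hgh.freeEnergy_eq hB hN, mul_inv_cancel_left₀ this]
  have hsub : Subadditive u := by
    intro N₁ N₂
    rcases Nat.eq_zero_or_pos N₁ with rfl | h₁
    · simp [hu0]
    rcases Nat.eq_zero_or_pos N₂ with rfl | h₂
    · simp [hu0]
    rw [huN _ h₁, huN _ h₂, huN _ (by omega)]
    linarith [hgh.add_integral_le hB h₁ h₂ (c + m)]
  have hbdd : BddBelow (range fun N => u N / N) := by
    refine ⟨-(Real.log 2 + |c + m| + mixture B v 1 / 2), ?_⟩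
    rintro _ ⟨N, rfl⟩
    have hκ := mixture_one_nonneg (B := B) (v := v)
    rcases Nat.eq_zero_or_pos N with rfl | hN
    · simp only [hu0, zero_div]
      have := Real.log_nonneg (by norm_num : (1 : ℝ) ≤ 2)
      have := abs_nonneg (c + m)
      linarith
    · have hN0 : (0 : ℝ) < N := by exact_mod_cast hN
      simp only [huN N hN]
      rw [le_div_iff₀ hN0]
      have h1 := (hgh.isCenteredGaussian hB hN).integral_logSumExp_le
        (fun σ => covKernel_le hs σ σ) (meanField 0 (c + m) N)
      have h2 := logSumExp_meanField_zero_le (c + m) N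
      simp only [fieldLaw]
      nlinarith
  have hlim := (hsub.tendsto_lim hbdd).neg
  refine ⟨_, hlim.congr' ?_⟩
  filter_upwards [eventually_ge_atTop 1] with N hN
  have : (N : ℝ) ≠ 0 := by positivity
  rw [hu]
  field_simp

end Limit

/-! ### Variational bounds for the ferromagnetic model. -/

section Variational

variable {Ω : Type*} [MeasurableSpace Ω] {P : Measure Ω} [IsProbabilityMeasure P]
  {β : ℝ} {B : ℕ+ → ℝ} {m : ℝ} {v : ℝ≥0} {g : Couplings Ω} {h : ℕ → Ω → ℝ} {N : ℕ}

lemma shiftField_zero {Ω : Type*} (h : ℕ → Ω → ℝ) : shiftField 0 h = h := by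
  funext i ω
  simp [shiftField]

lemma sum_spin_eq (hN : 1 ≤ N) (σ : Config N) : ∑ i, spin σ i = N * magnetization σ := by
  have : (N : ℝ) ≠ 0 := by positivity
  rw [magnetization, mul_inv_cancel_left₀ this]

lemma abs_magnetization_le (hN : 1 ≤ N) (σ : Config N) : |magnetization σ| ≤ 1 := by
  have hN0 : (0 : ℝ) < N := by exact_mod_cast hN
  have h1 := abs_sum_spin_le σ
  rw [sum_spin_eq hN, abs_mul, Nat.abs_cast] at h1
  nlinarith

/-- Completing the square in the ferromagnetic interaction. -/
lemma meanField_eq (hN : 1 ≤ N) (b c μ : ℝ) (σ : Config N) :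
    meanField b c N σ = meanField 0 (b * μ + c) N σ - N * (b * μ ^ 2 / 2)
      + N * (b * (magnetization σ - μ) ^ 2 / 2) := by
  rw [meanField, meanField, sum_spin_eq hN]
  ring

/-- Uniformity in `N` lets the bound pass to the limit, where it gives continuity in `μ`. -/
lemma IsDisorder.abs_freeEnergySK_sub_le (hB : (β, B) ∈ temperatures)
    (hgh : IsDisorder P g h m v) (hN : 1 ≤ N) (c c' : ℝ) :
    |freeEnergySK P B g (shiftField c h) N - freeEnergySK P B g (shiftField c' h) N|
      ≤ |c - c'| := by
  have hN0 : (0 : ℝ) < N := by exact_mod_cast hN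
  have hG := hgh.isCenteredGaussian hB hN
  have hG1 := hG.1
  rw [freeEnergySK, freeEnergySK, hgh.freeEnergy_eq hB hN, hgh.freeEnergy_eq hB hN, ← mul_sub,
    fieldLaw, ← integral_sub (hG.integrable_logSumExp _) (hG.integrable_logSumExp _), abs_mul,
    abs_of_pos (inv_pos.2 hN0), inv_mul_le_iff₀ hN0]
  have hb : ∀ x : Config N → ℝ, ‖logSumExp (meanField 0 (c + m) N + x)
      - logSumExp (meanField 0 (c' + m) N + x)‖ ≤ N * |c - c'| := by
    intro x
    rw [Real.norm_eq_abs]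
    refine abs_logSumExp_sub_le fun σ => ?_
    have e : (meanField 0 (c + m) N + x) σ - (meanField 0 (c' + m) N + x) σ
        = (c - c') * ∑ i, spin σ i := by
      simp only [Pi.add_apply, meanField]; ring
    rw [e, abs_mul, mul_comm]
    gcongr
    exact abs_sum_spin_le σ
  have := norm_integral_le_of_norm_le_const (μ := P.map fun ω => gaussianField B g h m N ω)
    (ae_of_all _ hb)
  simpa using this

lemma IsDisorder.freeEnergySK_sub_le_freeEnergy (hB : (β, B) ∈ temperatures)
    (hgh : IsDisorder P g h m v) (hN : 1 ≤ N) (μ : ℝ) :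
    freeEnergySK P B g (shiftField (β * μ) h) N - β * μ ^ 2 / 2 ≤ freeEnergy P β B g h N := by
  have hN0 : (0 : ℝ) < N := by exact_mod_cast hN
  have hG := hgh.isCenteredGaussian hB hN
  have hG1 := hG.1
  have e0 := hgh.freeEnergy_eq hB hN β 0
  rw [shiftField_zero] at e0
  rw [freeEnergySK, hgh.freeEnergy_eq hB hN, e0, sub_le_iff_le_add]
  have key : ∫ x, logSumExp (meanField 0 (β * μ + m) N + x) ∂(fieldLaw P B m g h N)
      ≤ ∫ x, logSumExp (meanField β (0 + m) N + x) ∂(fieldLaw P B m g h N)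
        + N * (β * μ ^ 2 / 2) := by
    have hi := (hG.integrable_logSumExp (meanField β (0 + m) N)).add
      (integrable_const (N * (β * μ ^ 2 / 2)))
    refine (integral_mono (hG.integrable_logSumExp _) hi fun x => ?_).trans (le_of_eq ?_)
    · change _ ≤ logSumExp _ + N * (β * μ ^ 2 / 2)
      rw [add_comm (logSumExp _), ← logSumExp_const_add]
      refine logSumExp_mono fun σ => ?_
      have hsq : 0 ≤ N * (β * (magnetization σ - μ) ^ 2 / 2) :=
        mul_nonneg hN0.le (div_nonneg (mul_nonneg hB.1 (sq_nonneg _)) zero_le_two)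
      simp only [Pi.add_apply]
      rw [meanField_eq hN β (0 + m) μ σ, zero_add]
      linarith
    · simp only [Pi.add_apply]
      rw [integral_add (hG.integrable_logSumExp _) (integrable_const _)]
      simp [fieldLaw]
  have := mul_le_mul_of_nonneg_left key (inv_pos.2 hN0).le
  rwa [mul_add, inv_mul_cancel_left₀ hN0.ne'] at this

/-- Upper bound for the free energy by the free energies for a finite set of external fields. -/
lemma IsDisorder.freeEnergy_le_of_finite (hB : (β, B) ∈ temperatures)
    (hgh : IsDisorder P g h m v) (hN : 1 ≤ N) {κ : Type*} [Fintype κ] [Nonempty κ] (μ : κ → ℝ)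
    {ε F : ℝ} (hμ : ∀ x : ℝ, |x| ≤ 1 → ∃ k, |x - μ k| ≤ ε)
    (hF : ∀ k, freeEnergySK P B g (shiftField (β * μ k) h) N - β * μ k ^ 2 / 2 ≤ F) :
    freeEnergy P β B g h N ≤ β * ε ^ 2 / 2 + F + (Real.log (Fintype.card κ) * (1 / N)
      + Fintype.card κ * (Real.pi / 2 * √(mixture B v 1 + 1)) * √(1 / N)) := by
  have hN0 : (0 : ℝ) < N := by exact_mod_cast hN
  have hs := summable_sq_of_temperatures hB
  have hG := hgh.isCenteredGaussian hB hN
  have hG1 := hG.1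
  have e0 := hgh.freeEnergy_eq hB hN β 0
  rw [shiftField_zero, zero_add] at e0
  change _ = (N : ℝ)⁻¹ * ∫ x, _ ∂(P.map fun ω => gaussianField B g h m N ω) at e0
  set ρ := P.map fun ω => gaussianField B g h m N ω
  set a : κ → Config N → ℝ := fun k => meanField 0 (β * μ k + m) N
  set E : κ → ℝ := fun k => ∫ x, logSumExp (a k + x) ∂ρ
  set w : κ → ℝ := fun k => N * (β * μ k ^ 2 / 2)
  -- Adding 1 keeps the scale in the concentration bound positive even when the Gaussian part is
  -- degenerate.
  set κ₁ := mixture B v 1 + 1 with hκ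
  have hκ0 : 0 < κ₁ := by
    have := mixture_one_nonneg (B := B) (v := v)
    linarith
  have hmix : N * mixture B v 1 ≤ √(N * κ₁) ^ 2 := by
    rw [Real.sq_sqrt (by positivity), hκ]
    nlinarith
  have hconc : ∀ k, ∫ x, |logSumExp (a k + x) - E k| ∂ρ ≤ Real.pi / 2 * √(N * κ₁) := fun k =>
    hG.integral_abs_logSumExp_sub_integral_le (Real.sqrt_pos.2 (by positivity))
      (fun σ τ => (covKernel_le hs σ τ).trans hmix) (a k)
  have hEk : ∀ k, E k - w k ≤ N * F + 0 := by
    intro k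
    have := hF k
    rw [freeEnergySK, hgh.freeEnergy_eq hB hN] at this
    have h2 := mul_le_mul_of_nonneg_left this hN0.le
    rw [mul_sub, mul_inv_cancel_left₀ hN0.ne'] at h2
    rw [add_zero]
    exact h2
  have hpt : ∀ x : Config N → ℝ, logSumExp (meanField β m N + x)
      ≤ N * (β * ε ^ 2 / 2) + (N * F + Real.log (Fintype.card κ))
        + ∑ k, |logSumExp (a k + x) - E k| := by
    intro x
    -- Each configuration is charged to a grid point near its magnetization; the other grid points
    -- only add positive terms.
    have s1 : logSumExp (meanField β m N + x)
        ≤ N * (β * ε ^ 2 / 2) + logSumExp fun k => logSumExp (a k + x) - w k := by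
      have e1 : logSumExp (fun k => logSumExp (a k + x) - w k)
          = Real.log (∑ k, ∑ σ, Real.exp (a k σ + x σ - w k)) := by
        rw [logSumExp]
        congr 1
        refine Finset.sum_congr rfl fun k _ => ?_
        rw [Real.exp_sub, logSumExp, Real.exp_log (sum_exp_pos _), Finset.sum_div]
        refine Finset.sum_congr rfl fun σ _ => ?_
        rw [Real.exp_sub, Pi.add_apply]
      have hpos : 0 < ∑ k, ∑ σ, Real.exp (a k σ + x σ - w k) :=
        Finset.sum_pos (fun k _ => sum_exp_pos fun σ => a k σ + x σ - w k)
          Finset.univ_nonempty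
      rw [e1, ← Real.log_exp (N * (β * ε ^ 2 / 2)),
        ← Real.log_mul (Real.exp_pos _).ne' hpos.ne', logSumExp]
      refine Real.log_le_log (sum_exp_pos _) ?_
      rw [Finset.sum_comm, Finset.mul_sum]
      refine Finset.sum_le_sum fun σ _ => ?_
      obtain ⟨k, hk⟩ := hμ _ (abs_magnetization_le hN σ)
      have hsq : (magnetization σ - μ k) ^ 2 ≤ ε ^ 2 := by
        rw [← sq_abs]
        exact pow_le_pow_left₀ (abs_nonneg _) hk 2
      have hb : N * (β * (magnetization σ - μ k) ^ 2 / 2) ≤ N * (β * ε ^ 2 / 2) := by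
        have := hB.1
        gcongr
      calc Real.exp ((meanField β m N + x) σ)
          ≤ Real.exp (N * (β * ε ^ 2 / 2)) * Real.exp (a k σ + x σ - w k) := by
            rw [← Real.exp_add, Real.exp_le_exp, Pi.add_apply, meanField_eq hN β m (μ k) σ]
            simp only [a, w]
            linarith
        _ ≤ _ := by
            gcongr
            exact Finset.single_le_sum (f := fun k => Real.exp (a k σ + x σ - w k))
              (fun k _ => (Real.exp_pos _).le) (Finset.mem_univ k)
    -- The random free energies are replaced by their means inside the outer log-sum-exp. It is
    -- Lipschitz for the sup norm, so the sum of the deviations bounds the error.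
    have s2 : |logSumExp (fun k => logSumExp (a k + x) - w k) - logSumExp fun k => E k - w k|
        ≤ ∑ k, |logSumExp (a k + x) - E k| := by
      refine abs_logSumExp_sub_le fun k => ?_
      rw [sub_sub_sub_cancel_right]
      exact Finset.single_le_sum (f := fun k => |logSumExp (a k + x) - E k|)
        (fun k _ => abs_nonneg _) (Finset.mem_univ k)
    have s3 : logSumExp (fun k => E k - w k) ≤ N * F + Real.log (Fintype.card κ) := by
      refine (logSumExp_mono hEk).trans (le_of_eq ?_)
      rw [logSumExp_const_add (N * F) fun _ => 0]
      simp [logSumExp]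
    linarith [le_abs_self (logSumExp (fun k => logSumExp (a k + x) - w k)
      - logSumExp fun k => E k - w k)]
  have hi : ∀ k, Integrable (fun x => |logSumExp (a k + x) - E k|) ρ := fun k =>
    ((hG.integrable_logSumExp (a k)).sub (integrable_const _)).abs
  have hint : ∫ x, logSumExp (meanField β m N + x) ∂ρ
      ≤ N * (β * ε ^ 2 / 2) + (N * F + Real.log (Fintype.card κ))
        + Fintype.card κ * (Real.pi / 2 * √(N * κ₁)) := by
    have hsum := integrable_finsetSum Finset.univ fun k _ => hi k
    refine (integral_mono (hG.integrable_logSumExp _)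
      ((integrable_const (N * (β * ε ^ 2 / 2) + (N * F + Real.log (Fintype.card κ)))).add hsum)
      hpt).trans ?_
    simp only [Pi.add_apply]
    rw [integral_add (integrable_const _) hsum, integral_finsetSum _ fun k _ => hi k]
    have h1 : ∑ k, ∫ x, |logSumExp (a k + x) - E k| ∂ρ
        ≤ ∑ _k : κ, Real.pi / 2 * √(N * κ₁) := Finset.sum_le_sum fun k _ => hconc k
    rw [Finset.sum_const, Finset.card_univ, nsmul_eq_mul] at h1
    simpa using h1
  rw [e0]
  refine (mul_le_mul_of_nonneg_left hint (inv_pos.2 hN0).le).trans (le_of_eq ?_)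
  have hsqrt : (N : ℝ)⁻¹ * √(N * κ₁) = √κ₁ * √(1 / N) := by
    rw [Real.sqrt_mul hN0.le, Real.sqrt_div zero_le_one, Real.sqrt_one]
    have : (N : ℝ)⁻¹ * √N = 1 / √N := by
      rw [inv_mul_eq_div, Real.sqrt_div_self]
      simp
    rw [← mul_assoc, this]
    ring
  calc _ = (N : ℝ)⁻¹ * N * (β * ε ^ 2 / 2) + (N : ℝ)⁻¹ * N * F
        + (N : ℝ)⁻¹ * Real.log (Fintype.card κ)
        + Fintype.card κ * (Real.pi / 2) * ((N : ℝ)⁻¹ * √(N * κ₁)) := by ring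
    _ = _ := by rw [hsqrt, inv_mul_cancel₀ hN0.ne']; ring

lemma exists_grid_near (K : ℕ) {x : ℝ} (hx : |x| ≤ 1) :
    ∃ k : Fin (K + 2), |x - (-1 + k * (2 / ((K : ℝ) + 1)))| ≤ 2 / ((K : ℝ) + 1) := by
  rw [abs_le] at hx
  have hK : (0 : ℝ) < (K : ℝ) + 1 := by positivity
  set y := (x + 1) * ((K + 1) / 2) with hy
  have hy0 : 0 ≤ y := mul_nonneg (by linarith) (by positivity)
  have hyK : y ≤ K + 1 := by rw [hy]; nlinarith
  -- At `x = 1` the index `K + 1` is attained, so `K + 2` grid points are needed.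
  have hfl : ⌊y⌋₊ < K + 2 := by
    have : (⌊y⌋₊ : ℝ) ≤ K + 1 := (Nat.floor_le hy0).trans hyK
    have : ⌊y⌋₊ ≤ K + 1 := by exact_mod_cast this
    omega
  refine ⟨⟨⌊y⌋₊, hfl⟩, ?_⟩
  have e : x - (-1 + (⌊y⌋₊ : ℝ) * (2 / ((K : ℝ) + 1))) = (y - ⌊y⌋₊) * (2 / ((K : ℝ) + 1)) := by
    rw [hy]; field_simp; ring
  have h1 := Nat.floor_le hy0
  have h2 := Nat.lt_floor_add_one y
  simp only
  rw [e, abs_mul, abs_of_pos (by positivity : 0 < 2 / ((K : ℝ) + 1)),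
    abs_of_nonneg (by linarith)]
  exact mul_le_of_le_one_left (by positivity) (by linarith)

lemma grid_mem_Icc {K : ℕ} (k : Fin (K + 2)) :
    -1 + (k : ℝ) * (2 / ((K : ℝ) + 1)) ∈ Icc (-1 : ℝ) 1 := by
  have hk : (k : ℝ) ≤ K + 1 := by
    have := k.2
    exact_mod_cast (by omega : (k : ℕ) ≤ K + 1)
  have hK : (0 : ℝ) < (K : ℝ) + 1 := by positivity
  have hs : (k : ℝ) * (2 / ((K : ℝ) + 1)) ≤ 2 := by
    rw [mul_div_assoc', div_le_iff₀ hK]; linarith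
  have h0 : 0 ≤ (k : ℝ) * (2 / ((K : ℝ) + 1)) := by positivity
  constructor <;> linarith

lemma IsDisorder.eventually_freeEnergy_lt (hB : (β, B) ∈ temperatures)
    (hgh : IsDisorder P g h m v) {F u : ℝ} (hu : F < u)
    (hF : ∀ μ ∈ Icc (-1 : ℝ) 1, ∀ᶠ N in atTop,
      freeEnergySK P B g (shiftField (β * μ) h) N - β * μ ^ 2 / 2 < F + (u - F) / 4) :
    ∀ᶠ N in atTop, freeEnergy P β B g h N < u := by
  -- Three quarters of the gap are spent: on the grid spacing, on the error in `N`, and on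
  -- convergence at the grid points. The grid is fixed before `N`, so only finitely many limits are
  -- used.
  have hδ : 0 < (u - F) / 4 := by linarith
  have hgrid : Tendsto (fun K : ℕ => β * (2 / ((K : ℝ) + 1)) ^ 2 / 2) atTop (𝓝 0) := by
    have h1 := (tendsto_one_div_add_atTop_nhds_zero_nat (𝕜 := ℝ)).const_mul 2
    have h2 := ((h1.pow 2).const_mul β).div_const 2
    simpa [mul_one_div, div_eq_mul_inv] using h2
  obtain ⟨K, hK⟩ := (hgrid.eventually (gt_mem_nhds hδ)).exists
  set ε := 2 / ((K : ℝ) + 1)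
  set c := (Fintype.card (Fin (K + 2)) : ℝ)
  have herr : Tendsto (fun N : ℕ => Real.log c * (1 / (N : ℝ))
      + c * (Real.pi / 2 * √(mixture B v 1 + 1)) * √(1 / (N : ℝ))) atTop (𝓝 0) := by
    have h1 := tendsto_one_div_atTop_nhds_zero_nat (𝕜 := ℝ)
    simpa using (h1.const_mul (Real.log c)).add
      (h1.sqrt.const_mul (c * (Real.pi / 2 * √(mixture B v 1 + 1))))
  have hall : ∀ᶠ N in atTop, ∀ k : Fin (K + 2),
      freeEnergySK P B g (shiftField (β * (-1 + k * ε)) h) N - β * (-1 + k * ε) ^ 2 / 2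
        < F + (u - F) / 4 :=
    eventually_all.2 fun k => hF _ (grid_mem_Icc k)
  filter_upwards [herr.eventually (gt_mem_nhds hδ), hall, eventually_ge_atTop 1] with N h1 h2 hN
  have := hgh.freeEnergy_le_of_finite hB hN (fun k : Fin (K + 2) => -1 + k * ε)
    (fun x hx => exists_grid_near K hx) fun k => (h2 k).le
  linarith

end Variational

end SKFI

end

/-! ### Conclusion: the limit and its maximizer. -/

theorem theorem1 {Ω : Type*} [MeasurableSpace Ω] (P : Measure Ω) [IsProbabilityMeasure P]
    (β : ℝ) (B : ℕ+ → ℝ) (hB : (β, B) ∈ SKFI.temperatures)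
    (m : ℝ) (v : ℝ≥0) (g : SKFI.Couplings Ω) (h : ℕ → Ω → ℝ)
    (hgh : SKFI.IsDisorder P g h m v) :
    -- the Hamiltonians and the free energies are well defined
    (∀ N : ℕ, 1 ≤ N →
      (∀ᵐ ω ∂P, ∀ σ : SKFI.Config N, Summable (SKFI.pSpinTerm B g N ω σ)) ∧
      Integrable (fun ω => Real.log (SKFI.partitionFunction β B g h N ω)) P ∧
      ∀ μ ∈ Icc (-1 : ℝ) 1, Integrable (fun ω => Real.log
        (SKFI.partitionFunction 0 B g (SKFI.shiftField (β * μ) h) N ω)) P) ∧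
    -- the limiting free energies of the SK model exist
    (∀ μ ∈ Icc (-1 : ℝ) 1,
      Tendsto (SKFI.freeEnergySK P B g (SKFI.shiftField (β * μ) h)) atTop
        (𝓝 (SKFI.limitFreeEnergySK P B g (SKFI.shiftField (β * μ) h)))) ∧
    -- the limit of the free energies exists and is the maximum
    ∃ F : ℝ, Tendsto (SKFI.freeEnergy P β B g h) atTop (𝓝 F) ∧
      IsGreatest ((fun μ : ℝ =>
        SKFI.limitFreeEnergySK P B g (SKFI.shiftField (β * μ) h) - β * μ ^ 2 / 2) ''
          Icc (-1 : ℝ) 1) F := by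
  have hlim : ∀ c : ℝ, Tendsto (SKFI.freeEnergySK P B g (SKFI.shiftField c h)) atTop
      (𝓝 (SKFI.limitFreeEnergySK P B g (SKFI.shiftField c h))) := by
    intro c
    obtain ⟨F, hF⟩ := hgh.exists_tendsto_freeEnergySK hB c
    rwa [SKFI.limitFreeEnergySK, hF.limUnder_eq]
  refine ⟨fun N hN => ⟨hgh.ae_summable_pSpinTerm hB hN, ?_, fun μ _ =>
    hgh.integrable_log_partitionFunction hB hN 0 (β * μ)⟩, fun μ _ => hlim _, ?_⟩
  · simpa only [SKFI.shiftField_zero] using hgh.integrable_log_partitionFunction hB hN β 0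
  have hLip : ∀ c c' : ℝ, |SKFI.limitFreeEnergySK P B g (SKFI.shiftField c h)
      - SKFI.limitFreeEnergySK P B g (SKFI.shiftField c' h)| ≤ |c - c'| := by
    intro c c'
    refine le_of_tendsto ((hlim c).sub (hlim c')).abs ?_
    filter_upwards [eventually_ge_atTop 1] with N hN
    exact hgh.abs_freeEnergySK_sub_le hB hN c c'
  have hcont : Continuous fun c : ℝ => SKFI.limitFreeEnergySK P B g (SKFI.shiftField c h) :=
    (LipschitzWith.of_dist_le_mul (K := 1) fun c c' => by
      simpa [Real.dist_eq] using hLip c c').continuous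
  have hcont' : Continuous fun μ : ℝ =>
      SKFI.limitFreeEnergySK P B g (SKFI.shiftField (β * μ) h) - β * μ ^ 2 / 2 :=
    (hcont.comp (continuous_const.mul continuous_id)).sub (by fun_prop)
  obtain ⟨μ₀, hμ₀, hmax⟩ := (isCompact_Icc (a := (-1 : ℝ)) (b := 1)).exists_isMaxOn
    (nonempty_Icc.2 (by norm_num)) hcont'.continuousOn
  refine ⟨_, ?_, mem_image_of_mem _ hμ₀, ?_⟩
  · refine tendsto_order.2 ⟨fun l hl => ?_, fun u hu => ?_⟩
    · filter_upwards [((hlim (β * μ₀)).sub_const (β * μ₀ ^ 2 / 2)).eventually (lt_mem_nhds hl),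
        eventually_ge_atTop 1] with N h1 hN
      exact h1.trans_le (hgh.freeEnergySK_sub_le_freeEnergy hB hN μ₀)
    · refine hgh.eventually_freeEnergy_lt hB hu fun μ hμ => ?_
      refine ((hlim (β * μ)).sub_const (β * μ ^ 2 / 2)).eventually (gt_mem_nhds ?_)
      have h1 : SKFI.limitFreeEnergySK P B g (SKFI.shiftField (β * μ) h) - β * μ ^ 2 / 2
        ≤ SKFI.limitFreeEnergySK P B g (SKFI.shiftField (β * μ₀) h) - β * μ₀ ^ 2 / 2 := hmax hμ
      linarith
  · rintro _ ⟨μ, hμ, rfl⟩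
    exact hmax hμ
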